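/- Let $k$ be a field and $\mathcal{A}$ an essentially small additive category which is $k$-trivial: for all objects $x,y$ of $\mathcal{A}$ the abelian group $\mathcal{A}(x,y)$ is finite, of order invertible in $k$. Let $\mathbf{Rep}(\mathcal{A})$ be the category of additive functors from $\mathcal{A}$ to abelian groups and $\mathcal{F}(\mathcal{A};k)$ the category of all functors from $\mathcal{A}$ to $k$-vector spaces. For $A$ in $\mathbf{Rep}(\mathcal{A})$, let $k[A]$ in $\mathcal{F}(\mathcal{A};k)$ be the functor $a\mapsto k[A(a)]$, the $k$-vector space with basis the set $A(a)$, and put $$\mathrm{Q}_A=\mathrm{Coker}\Big(\bigoplus_{B\subsetneq A}k[B]\to k[A]\Big),\qquad \mathrm{Q}^A=\mathrm{Ker}\Big(k[A]\to\prod_{0\neq B\subseteq A}k[A/B]\Big),$$ where $B$ runs over subfunctors of $A$ in $\mathbf{Rep}(\mathcal{A})$; the group $\mathrm{Aut}(A)$ acts on both. For a $k[\mathrm{Aut}(A)]$-module $M$, let $\mathrm{Q}(A,M)$ be the image of the morphism $$M\otimes_{k[\mathrm{Aut}(A)]}\mathrm{Q}^A\to M\otimes_{k[\mathrm{Aut}(A)]}\mathrm{Q}_A$$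 of $\mathcal{F}(\mathcal{A};k)$ induced by the canonical composite $\mathrm{Q}^A\hookrightarrow k[A]\twoheadrightarrow \mathrm{Q}_A$; here $M\otimes_{k[\mathrm{Aut}(A)]}X$ denotes the coinvariants $(M\otimes_k X)_{\mathrm{Aut}(A)}$ of the diagonal action. An object of an abelian category has finite length if it is artinian and noetherian. Then, for every $A$ in $\mathbf{Rep}(\mathcal{A})$, the functor $k[A]$ has finite length in $\mathcal{F}(\mathcal{A};k)$ if and only if $A$ has finite length in $\mathbf{Rep}(\mathcal{A})$. In that case, a functor $S$ in $\mathcal{F}(\mathcal{A};k)$ is isomorphic to a composition factor of $k[A]$ if and only if $S\simeq\mathrm{Q}(B,M)$ for some subquotient $B$ of $A$ in $\mathbf{Rep}(\mathcal{A})$ and some simple $k[\mathrm{Aut}(B)]$-module $M$. -/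

import Mathlib

open CategoryTheory CategoryTheory.Limits

universe w v u

noncomputable section

namespace AddRepLin

section Generalities

variable {C : Type u} [Category.{v} C]

/-- An object has finite length if it is both artinian and noetherian. -/
def IsFiniteLength (X : C) : Prop :=
  IsArtinianObject X ∧ IsNoetherianObject X

/-- `Y` is a subquotient of `X`: a quotient of a subobject of `X`. -/
def IsSubquotient (Y X : C) : Prop :=
  ∃ (Z : C) (i : Z ⟶ X) (p : Z ⟶ Y), Mono i ∧ Epi p

variable [Abelian C]

/-- A finite chain `0 = X₀ ≤ X₁ ≤ ⋯ ≤ Xₙ = X` of subobjects whose successive quotients are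
simple. -/
structure CompSeries (X : C) where
  /-- the number of steps -/
  length : ℕ
  /-- the members of the chain -/
  sub : Fin (length + 1) → Subobject X
  sub_zero : sub 0 = ⊥
  sub_last : sub (Fin.last length) = ⊤
  le_succ : ∀ i : Fin length, sub i.castSucc ≤ sub i.succ
  simple : ∀ i : Fin length, Simple (cokernel (Subobject.ofLE _ _ (le_succ i)))

/-- The `i`-th successive quotient of a composition series. -/
def CompSeries.factor {X : C} (s : CompSeries X) (i : Fin s.length) : C :=
  cokernel (Subobject.ofLE _ _ (s.le_succ i))

/-- `S` is (up to isomorphism) a composition factor of `X`. By the Jordan-Hölder theorem it does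
not matter which composition series is used. -/
def IsCompositionFactor (S X : C) : Prop :=
  ∃ (s : CompSeries X) (i : Fin s.length), Nonempty (S ≅ s.factor i)

end Generalities

variable (k : Type w) [Field k] {𝒜 : Type u} [Category.{v} 𝒜] [Preadditive 𝒜]

variable (𝒜) in
/-- `𝒜` is `k`-trivial: its Hom groups are finite, of order invertible in `k`. -/
def IsTrivialFor : Prop :=
  ∀ x y : 𝒜, Finite (x ⟶ y) ∧ IsUnit (Nat.card (x ⟶ y) : k)

/-- The linearization `k[A] : a ↦ k[A(a)]` of an additive functor `A`, an object of the category
of all functors from `𝒜` to `k`-vector spaces. -/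
def linearization (A : 𝒜 ⥤+ AddCommGrpCat.{w}) : 𝒜 ⥤ ModuleCat.{w} k :=
  A.obj ⋙ forget AddCommGrpCat.{w} ⋙ ModuleCat.free k

/-- A subfunctor of an additive functor `A`, with values in abelian groups. -/
structure AddSubfunctor (A : 𝒜 ⥤+ AddCommGrpCat.{w}) where
  /-- the value of the subfunctor -/
  obj (a : 𝒜) : AddSubgroup (A.obj.obj a)
  map_mem {a b : 𝒜} (f : a ⟶ b) {x : A.obj.obj a} (hx : x ∈ obj a) :
    (A.obj.map f).hom x ∈ obj b

namespace AddSubfunctor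

variable {A : 𝒜 ⥤+ AddCommGrpCat.{w}}

/-- `B ⊊ A`. -/
def IsProper (B : AddSubfunctor A) : Prop := ∃ a, B.obj a ≠ ⊤

/-- `B ≠ 0`. -/
def IsNonzero (B : AddSubfunctor A) : Prop := ∃ a, B.obj a ≠ ⊥

/-- The inverse image of a subfunctor under an endomorphism. -/
def comap (B : AddSubfunctor A) (g : A ⟶ A) : AddSubfunctor A where
  obj a := (B.obj a).comap (g.hom.app a).hom
  map_mem {a b} f {x} hx := by
    have h := ConcreteCategory.congr_hom (g.hom.naturality f) x
    have h' := B.map_mem f (AddSubgroup.mem_comap.1 hx)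
    rw [AddSubgroup.mem_comap]
    simp only [ConcreteCategory.comp_apply] at h
    exact (congrArg (· ∈ B.obj b) h).mpr h'

end AddSubfunctor

variable (A : 𝒜 ⥤+ AddCommGrpCat.{w})

/-- `k[A(a)] → k[A(a)]` induced by an endomorphism of `A`. -/
def linEnd (g : A ⟶ A) (a : 𝒜) : (A.obj.obj a →₀ k) →ₗ[k] (A.obj.obj a →₀ k) :=
  Finsupp.lmapDomain k k (g.hom.app a).hom

/-- `k[A(a)] → k[A(b)]` induced by a morphism `a ⟶ b` of `𝒜`. -/
def linMap {a b : 𝒜} (f : a ⟶ b) : (A.obj.obj a →₀ k) →ₗ[k] (A.obj.obj b →₀ k) :=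
  Finsupp.lmapDomain k k (A.obj.map f).hom

/-- The (left) action of the group `Aut(A)` on `k[A(a)]`. -/
def linRep (a : 𝒜) : Representation k (Aut A) (A.obj.obj a →₀ k) where
  toFun g := linEnd k A g.hom a
  map_one' := by
    ext x : 2
    simp only [linEnd, LinearMap.comp_apply, Finsupp.lsingle_apply, Finsupp.lmapDomain_apply,
      Finsupp.mapDomain_single]
    rfl
  map_mul' g h := by
    ext x : 2
    simp only [linEnd, LinearMap.comp_apply, Module.End.mul_apply, Finsupp.lsingle_apply,
      Finsupp.lmapDomain_apply, Finsupp.mapDomain_single]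
    rfl

/-- The value at `a` of the image of `⨁ k[B] → k[A]`, the sum being over all `B ⊊ A`. -/
def properSum (a : 𝒜) : Submodule k (A.obj.obj a →₀ k) :=
  ⨆ (B : AddSubfunctor A) (_ : B.IsProper),
    LinearMap.range (Finsupp.lmapDomain k k (B.obj a).subtype)

/-- The value at `a` of the kernel of `k[A] → ∏ k[A/B]`, the product being over all
`0 ≠ B ⊆ A`. -/
def quotKer (a : 𝒜) : Submodule k (A.obj.obj a →₀ k) :=
  ⨅ (B : AddSubfunctor A) (_ : B.IsNonzero),
    LinearMap.ker (Finsupp.lmapDomain k k (QuotientAddGroup.mk' (B.obj a)))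

lemma lmapDomain_range_le {S T S' T' : Type w} (i : S → T) (i' : S' → T') (φ : T → T')
    (ψ : S → S') (h : ∀ x, φ (i x) = i' (ψ x)) :
    LinearMap.range (Finsupp.lmapDomain k k i) ≤
      (LinearMap.range (Finsupp.lmapDomain k k i')).comap (Finsupp.lmapDomain k k φ) := by
  rintro _ ⟨y, rfl⟩
  refine ⟨Finsupp.lmapDomain k k ψ y, ?_⟩
  simp only [Finsupp.lmapDomain_apply, ← Finsupp.mapDomain_comp]
  exact congrArg (fun m => Finsupp.mapDomain m y) (funext fun x => (h x).symm)

lemma lmapDomain_ker_le {S T S' T' : Type w} (p : S → T) (p' : S' → T') (φ : S → S')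
    (ψ : T → T') (h : ∀ x, p' (φ x) = ψ (p x)) :
    LinearMap.ker (Finsupp.lmapDomain k k p) ≤
      (LinearMap.ker (Finsupp.lmapDomain k k p')).comap (Finsupp.lmapDomain k k φ) := by
  intro y hy
  simp only [LinearMap.mem_ker, Submodule.mem_comap, Finsupp.lmapDomain_apply,
    ← Finsupp.mapDomain_comp] at hy ⊢
  rw [show p' ∘ φ = ψ ∘ p from funext h, Finsupp.mapDomain_comp, hy, Finsupp.mapDomain_zero]

lemma properSum_le_comap_linEnd (g : Aut A) (a : 𝒜) :
    properSum k A a ≤ (properSum k A a).comap (linRep k A a g) := by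
  have hg : ∀ (b : 𝒜) (x : A.obj.obj b), (g.inv.hom.app b).hom ((g.hom.hom.app b).hom x) = x :=
    fun b x => ConcreteCategory.congr_hom
      (congrArg (fun h : A ⟶ A => h.hom.app b) g.hom_inv_id) x
  refine iSup₂_le fun B hB => ?_
  have hB' : (B.comap g.inv).IsProper := by
    obtain ⟨b, hb⟩ := hB
    refine ⟨b, fun h => hb ((AddSubgroup.eq_top_iff' _).2 fun x => ?_)⟩
    have := (AddSubgroup.eq_top_iff' _).1 h ((g.hom.hom.app b).hom x)
    rw [← hg b x]
    exact this
  refine (lmapDomain_range_le k (B.obj a).subtype ((B.comap g.inv).obj a).subtype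
    (g.hom.hom.app a).hom (fun x : B.obj a => ⟨(g.hom.hom.app a).hom x.1, ?_⟩)
    fun x => rfl).trans (Submodule.comap_mono (le_iSup₂
      (f := fun (B : AddSubfunctor A) (_ : B.IsProper) =>
        LinearMap.range (Finsupp.lmapDomain k k (B.obj a).subtype)) (B.comap g.inv) hB'))
  change (g.inv.hom.app a).hom ((g.hom.hom.app a).hom x.1) ∈ B.obj a
  rw [hg]
  exact x.2

lemma properSum_le_comap_linMap {a b : 𝒜} (f : a ⟶ b) :
    properSum k A a ≤ (properSum k A b).comap (linMap k A f) :=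
  iSup₂_le fun B hB =>
    (lmapDomain_range_le k (B.obj a).subtype (B.obj b).subtype (A.obj.map f).hom
      (fun x : B.obj a => ⟨(A.obj.map f).hom x.1, B.map_mem f x.2⟩) fun _ => rfl).trans
      (Submodule.comap_mono (le_iSup₂ (f := fun (B : AddSubfunctor A) (_ : B.IsProper) =>
        LinearMap.range (Finsupp.lmapDomain k k (B.obj b).subtype)) B hB))

lemma quotKer_le_comap_linEnd (g : Aut A) (a : 𝒜) :
    quotKer k A a ≤ (quotKer k A a).comap (linRep k A a g) := by
  have hg' : ∀ (b : 𝒜) (x : A.obj.obj b), (g.hom.hom.app b).hom ((g.inv.hom.app b).hom x) = x :=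
    fun b x => ConcreteCategory.congr_hom
      (congrArg (fun h : A ⟶ A => h.hom.app b) g.inv_hom_id) x
  intro y hy
  simp only [quotKer, Submodule.mem_comap, Submodule.mem_iInf] at hy ⊢
  intro B hB
  have hB' : (B.comap g.hom).IsNonzero := by
    obtain ⟨b, hb⟩ := hB
    refine ⟨b, fun h => hb ((AddSubgroup.eq_bot_iff_forall _).2 fun x hx => ?_)⟩
    have := (AddSubgroup.eq_bot_iff_forall _).1 h ((g.inv.hom.app b).hom x) (by
      change (g.hom.hom.app b).hom ((g.inv.hom.app b).hom x) ∈ B.obj b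
      rw [hg']
      exact hx)
    rw [← hg' b x, this, map_zero]
  exact lmapDomain_ker_le k _ (QuotientAddGroup.mk' (B.obj a)) _
    (QuotientAddGroup.map ((B.comap g.hom).obj a) (B.obj a) (g.hom.hom.app a).hom le_rfl)
    (fun x => rfl) (hy (B.comap g.hom) hB')

lemma quotKer_le_comap_linMap {a b : 𝒜} (f : a ⟶ b) :
    quotKer k A a ≤ (quotKer k A b).comap (linMap k A f) := by
  intro y hy
  simp only [quotKer, Submodule.mem_comap, Submodule.mem_iInf] at hy ⊢
  intro B hB
  exact lmapDomain_ker_le k _ (QuotientAddGroup.mk' (B.obj b)) _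
    (QuotientAddGroup.map (B.obj a) (B.obj b) (A.obj.map f).hom fun x hx => B.map_mem f hx)
    (fun x => rfl) (hy B hB)

lemma linMap_comp_linRep {a b : 𝒜} (f : a ⟶ b) (g : Aut A) :
    linMap k A f ∘ₗ linRep k A a g = linRep k A b g ∘ₗ linMap k A f := by
  ext x : 2
  have h := ConcreteCategory.congr_hom (g.hom.hom.naturality f) x
  simp only [linMap, linRep, linEnd, MonoidHom.coe_mk, OneHom.coe_mk, LinearMap.comp_apply,
    Finsupp.lsingle_apply, Finsupp.lmapDomain_apply, Finsupp.mapDomain_single]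
  exact congrArg (fun z => Finsupp.single z (1 : k)) h.symm

lemma linMap_id (a : 𝒜) : linMap k A (𝟙 a) = LinearMap.id := by
  ext x : 2
  simp [linMap]

lemma linMap_comp {a b c : 𝒜} (f : a ⟶ b) (g : b ⟶ c) :
    linMap k A (f ≫ g) = linMap k A g ∘ₗ linMap k A f := by
  ext x : 2
  simp [linMap, Finsupp.mapDomain_single]

/-- The action of `Aut(A)` on `Q_A(a)`. -/
def QlowerRep (a : 𝒜) : Representation k (Aut A) ((A.obj.obj a →₀ k) ⧸ properSum k A a) :=
  (linRep k A a).quotient (properSum k A a) fun g => properSum_le_comap_linEnd k A g a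

/-- The action of `Aut(A)` on `Q^A(a)`. -/
def QupperRep (a : 𝒜) : Representation k (Aut A) (quotKer k A a) :=
  (linRep k A a).subrepresentation (quotKer k A a) fun g => quotKer_le_comap_linEnd k A g a

/-- The map `Q_A(a) → Q_A(b)` induced by `a ⟶ b`. -/
def QlowerMap {a b : 𝒜} (f : a ⟶ b) : (QlowerRep k A a).IntertwiningMap (QlowerRep k A b) where
  toLinearMap := Submodule.mapQ _ _ (linMap k A f) (properSum_le_comap_linMap k A f)
  isIntertwining' g := Submodule.linearMap_qext _ (LinearMap.ext fun x =>
    congrArg (Submodule.mkQ _) (LinearMap.congr_fun (linMap_comp_linRep k A f g) x))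

/-- The map `Q^A(a) → Q^A(b)` induced by `a ⟶ b`. -/
def QupperMap {a b : 𝒜} (f : a ⟶ b) : (QupperRep k A a).IntertwiningMap (QupperRep k A b) where
  toLinearMap := (linMap k A f).restrict (quotKer_le_comap_linMap k A f)
  isIntertwining' g := LinearMap.ext fun x =>
    Subtype.ext (LinearMap.congr_fun (linMap_comp_linRep k A f g) x.1)

/-- The functor `Q_A = coker (⨁_{B ⊊ A} k[B] → k[A])`, with the action of `Aut(A)`. -/
def Qlower : 𝒜 ⥤ Rep.{w} k (Aut A) where
  obj a := Rep.of (QlowerRep k A a)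
  map f := Rep.ofHom (QlowerMap k A f)
  map_id a := Rep.hom_ext (Representation.IntertwiningMap.ext
    (Submodule.linearMap_qext _ (LinearMap.ext fun x =>
      congrArg (Submodule.mkQ _) (LinearMap.congr_fun (linMap_id k A a) x))))
  map_comp f g := Rep.hom_ext (Representation.IntertwiningMap.ext
    (Submodule.linearMap_qext _ (LinearMap.ext fun x =>
      congrArg (Submodule.mkQ _) (LinearMap.congr_fun (linMap_comp k A f g) x))))

/-- The functor `Q^A = ker (k[A] → ∏_{0 ≠ B ⊆ A} k[A/B])`, with the action of `Aut(A)`. -/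
def Qupper : 𝒜 ⥤ Rep.{w} k (Aut A) where
  obj a := Rep.of (X := quotKer k A a) (QupperRep k A a)
  map {a b} f := Rep.ofHom (X := quotKer k A a) (Y := quotKer k A b) (QupperMap k A f)
  map_id a := Rep.hom_ext (Representation.IntertwiningMap.ext (LinearMap.ext fun x =>
    Subtype.ext (LinearMap.congr_fun (linMap_id k A a) x.1)))
  map_comp f g := Rep.hom_ext (Representation.IntertwiningMap.ext (LinearMap.ext fun x => by
    exact Subtype.ext (LinearMap.congr_fun (linMap_comp k A f g) x.1)))

/-- The composite `Q^A(a) ↪ k[A(a)] ↠ Q_A(a)`. -/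
def QupperToQlowerMap (a : 𝒜) : (QupperRep k A a).IntertwiningMap (QlowerRep k A a) where
  toLinearMap := (properSum k A a).mkQ ∘ₗ (quotKer k A a).subtype
  isIntertwining' _ := rfl

/-- The canonical `Aut(A)`-equivariant morphism `Q^A ↪ k[A] ↠ Q_A`. -/
def QupperToQlower : Qupper k A ⟶ Qlower k A where
  app a := Rep.ofHom (X := quotKer k A a) (QupperToQlowerMap k A a)
  naturality _ _ _ := rfl

variable {k A}

/-- The functor `Q(A, M)` attached to an additive functor `A` and a `k`-linear representation `M`
of `Aut(A)`: the image of the morphism `M ⊗_{k[Aut(A)]} Q^A → M ⊗_{k[Aut(A)]} Q_A` obtained from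
`Q^A ↪ k[A] ↠ Q_A`. The tensor product over `k[Aut(A)]` is the space of coinvariants of the
tensor product over `k`, under the diagonal action of `Aut(A)`. -/
def Q (M : Rep.{w} k (Aut A)) : 𝒜 ⥤ ModuleCat.{w} k :=
  image (Functor.whiskerRight (QupperToQlower k A) ((Rep.coinvariantsTensor k (Aut A)).obj M))

end AddRepLin

end

/-!
A functor `A` of finite length has a generator `x ∈ A(a)`, of which every element is an image, and
an object `c` such that every nonzero element has a nonzero image in `A(c)`. The generators in
`A(b)` form a basis of `Q_A(b)` on which `Aut(A)` acts freely, so an element of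
`M ⊗_{k[Aut(A)]} Q_A` is an equivariant family of vectors of `M` indexed by them.

Let `y` be another generator in `A(a)`, outside the orbit of `x`. The elements `f x` with `f y = 0`
form a nonzero subfunctor of `A`, whose values have order invertible in `k`, and an element of
`Q^A(b)` vanishes modulo it. Averaging lifts to `k[𝒜(a, b)]` therefore gives linear combinations of
morphisms which send `x` to any prescribed element of `Q^A(b)` and kill the generators in the other
orbits. Hence every nonzero element of `M ⊗ Q_A` generates the image of some `m ⊗ Q^A` with `m ≠ 0`,
and `Q(A, M)` is simple when `M` is.

Finally `k[A]` is built, up to subquotients, from the `k[B]` with `B` a proper subfunctor and from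
`M ⊗ Q_A` with `M` finite-dimensional; for `M` simple, the cokernel of `Q(A, M) → M ⊗ Q_A` is built
from the `k[A/B]` with `B ≠ 0`. So one inducts on the subquotients of `A`, inside the Serre class of
the functors of finite length whose simple subquotients are of the form `Q(B, M)`.
-/

noncomputable section

namespace AddRepLin

/-! ### Subobjects and finite length -/

section FiniteLength

variable {C : Type u} [Category.{v} C]

lemma isFiniteLength_iff (X : C) :
    IsFiniteLength X ↔ WellFoundedLT (Subobject X) ∧ WellFoundedGT (Subobject X) :=
  and_congr (ObjectProperty.is_iff _ _) (ObjectProperty.is_iff _ _)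

lemma isFiniteLength_of_strictMono {X : C} {α : Type*} [Preorder α] [WellFoundedLT α]
    [WellFoundedGT α] {f : Subobject X → α} (hf : StrictMono f) : IsFiniteLength X :=
  (isFiniteLength_iff X).2 ⟨hf.wellFoundedLT, hf.wellFoundedGT⟩

lemma IsFiniteLength.of_mono {X Y : C} (i : X ⟶ Y) [Mono i] (h : IsFiniteLength Y) :
    IsFiniteLength X := by
  obtain ⟨_, _⟩ := h
  exact ⟨isArtinianObject_of_mono i, isNoetherianObject_of_mono i⟩

lemma isIso_ofLE_iff {X : C} {P P' : Subobject X} (h : P ≤ P') :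
    IsIso (Subobject.ofLE P P' h) ↔ P' ≤ P := by
  refine ⟨fun _ => Subobject.le_of_comm (inv (Subobject.ofLE P P' h)) ?_, fun h' => ?_⟩
  · rw [IsIso.inv_comp_eq, Subobject.ofLE_arrow]
  · exact ⟨Subobject.ofLE P' P h', by simp, by simp⟩

lemma subobject_map_strictMono {X Y : C} (f : X ⟶ Y) [Mono f] :
    StrictMono (Subobject.map f).obj :=
  (Functor.monotone _).strictMono_of_injective (Subobject.map_obj_injective f)

variable [Abelian C]

lemma subobject_factors_of_epi {X Y Z : C} {P : Subobject Z} (e : X ⟶ Y) [Epi e] {f : Y ⟶ Z}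
    (h : P.Factors (e ≫ f)) : P.Factors f := by
  have sq : CommSq (P.factorThru _ h) e P.arrow f := ⟨by simp⟩
  have : StrongEpi e := strongEpi_of_epi e
  rw [← sq.fac_right]
  exact Subobject.factors_comp_arrow _

lemma subobject_pullback_factors_iff {X Y Z : C} (f : X ⟶ Y) (P : Subobject Y) (g : Z ⟶ X) :
    ((Subobject.pullback f).obj P).Factors g ↔ P.Factors (g ≫ f) := by
  constructor
  · intro h
    rw [← Subobject.factorThru_arrow _ g h, Category.assoc, ← (Subobject.isPullback f P).w,
      ← Category.assoc]
    exact Subobject.factors_comp_arrow _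
  · intro h
    rw [← (Subobject.isPullback f P).lift_snd (P.factorThru _ h) g (by simp)]
    exact Subobject.factors_comp_arrow _

lemma subobject_map_factors_comp_iff {X Y Z : C} (f : X ⟶ Y) [Mono f] (P : Subobject X)
    (g : Z ⟶ X) : ((Subobject.map f).obj P).Factors (g ≫ f) ↔ P.Factors g := by
  rw [← subobject_pullback_factors_iff, Subobject.pullback_map_self]

lemma subobject_pullback_strictMono {X Y : C} (q : X ⟶ Y) [Epi q] :
    StrictMono (Subobject.pullback q).obj := by
  refine strictMono_of_le_iff_le fun P P' => ⟨fun h => Functor.monotone _ h, fun h => ?_⟩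
  have : Epi (Subobject.pullbackπ q P) := by
    rw [← (Subobject.isPullback q P).isoPullback_hom_fst]
    infer_instance
  refine Subobject.le_of_factors (subobject_factors_of_epi (Subobject.pullbackπ q P) ?_)
  rw [(Subobject.isPullback q P).w, ← subobject_pullback_factors_iff]
  exact Subobject.factors_of_le _ h (Subobject.factors_self _)

lemma IsFiniteLength.of_epi {X Y : C} (q : X ⟶ Y) [Epi q] (h : IsFiniteLength X) :
    IsFiniteLength Y := by
  obtain ⟨_, _⟩ := (isFiniteLength_iff X).1 h
  exact isFiniteLength_of_strictMono (subobject_pullback_strictMono q)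

lemma subobject_le_of_pullback_le_of_image_le {S : ShortComplex C} (hS : S.Exact) [Mono S.f]
    {W W' : Subobject S.X₂} (hW : W ≤ W')
    (h₁ : (Subobject.pullback S.f).obj W' ≤ (Subobject.pullback S.f).obj W)
    (h₃ : imageSubobject (W'.arrow ≫ S.g) ≤ imageSubobject (W.arrow ≫ S.g)) : W' ≤ W := by
  have hI : (imageSubobject (W.arrow ≫ S.g)).Factors (W'.arrow ≫ S.g) := by
    refine Subobject.factors_of_le _ h₃ ?_
    have := Subobject.factors_comp_arrow (factorThruImageSubobject (W'.arrow ≫ S.g))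
    rwa [imageSubobject_arrow_comp] at this
  obtain ⟨A, e, _, w, hw⟩ := surjective_up_to_refinements_of_epi
    (factorThruImageSubobject (W.arrow ≫ S.g)) (Subobject.factorThru _ _ hI)
  let d := e - w ≫ Subobject.ofLE W W' hW
  have hd : (d ≫ W'.arrow) ≫ S.g = 0 := by
    have := congrArg (· ≫ (imageSubobject (W.arrow ≫ S.g)).arrow) hw
    simp only [Category.assoc, Subobject.factorThru_arrow, imageSubobject_arrow_comp] at this
    simp [d, this]
  have hdW : W.Factors (d ≫ W'.arrow) := by
    rw [← hS.lift_f _ hd, ← subobject_pullback_factors_iff]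
    refine Subobject.factors_of_le _ h₁ ?_
    rw [subobject_pullback_factors_iff, hS.lift_f]
    exact Subobject.factors_comp_arrow _
  refine Subobject.le_of_factors (subobject_factors_of_epi e ?_)
  have he : e ≫ W'.arrow = d ≫ W'.arrow + w ≫ W.arrow := by simp [d]
  rw [he]
  exact Subobject.factors_add _ _ hdW (Subobject.factors_comp_arrow w)

lemma IsFiniteLength.of_shortExact {S : ShortComplex C} (hS : S.ShortExact)
    (h₁ : IsFiniteLength S.X₁) (h₃ : IsFiniteLength S.X₃) : IsFiniteLength S.X₂ := by
  obtain ⟨_, _⟩ := (isFiniteLength_iff _).1 h₁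
  obtain ⟨_, _⟩ := (isFiniteLength_iff _).1 h₃
  have := hS.mono_f
  let F : Subobject S.X₂ → Subobject S.X₁ × Subobject S.X₃ := fun W =>
    ((Subobject.pullback S.f).obj W, imageSubobject (W.arrow ≫ S.g))
  have hF : Monotone F := fun W W' h => by
    refine ⟨Functor.monotone (Subobject.pullback S.f) h, ?_⟩
    change imageSubobject (W.arrow ≫ S.g) ≤ imageSubobject (W'.arrow ≫ S.g)
    rw [← Subobject.ofLE_arrow h, Category.assoc]
    exact imageSubobject_comp_le _ _
  exact isFiniteLength_of_strictMono fun W W' hW => lt_of_le_not_ge (hF hW.le) fun h =>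
    hW.not_ge (subobject_le_of_pullback_le_of_image_le hS.exact hW.le h.1 h.2)

lemma isFiniteLength_of_simple (S : C) [Simple S] : IsFiniteLength S := by
  have : Finite (Subobject S) := by
    classical exact Finite.of_equiv Bool IsSimpleOrder.equivBool.symm
  exact (isFiniteLength_iff S).2 ⟨Finite.to_wellFoundedLT, Finite.to_wellFoundedGT⟩

end FiniteLength

/-! ### Subquotients and composition factors -/

section Subquotient

variable {C : Type u} [Category.{v} C]

lemma IsSubquotient.of_mono {Y X X' : C} (h : IsSubquotient Y X) (i : X ⟶ X') [Mono i] :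
    IsSubquotient Y X' := by
  obtain ⟨Z, j, p, _, _⟩ := h
  exact ⟨Z, j ≫ i, p, inferInstance, inferInstance⟩

lemma IsSubquotient.of_epi {Y Y' X : C} (h : IsSubquotient Y X) (p : Y ⟶ Y') [Epi p] :
    IsSubquotient Y' X := by
  obtain ⟨Z, j, q, _, _⟩ := h
  exact ⟨Z, j, q ≫ p, inferInstance, inferInstance⟩

variable [Abelian C]

lemma IsSubquotient.of_epi_right {Y X X' : C} (h : IsSubquotient Y X) (p : X' ⟶ X) [Epi p] :
    IsSubquotient Y X' := by
  obtain ⟨Z, j, q, _, _⟩ := h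
  exact ⟨pullback p j, pullback.fst p j, pullback.snd p j ≫ q, inferInstance, inferInstance⟩

lemma exists_factorThruImage_comp_eq {X Y W : C} {u : X ⟶ Y} {q : X ⟶ W}
    (h : ∀ (K : C) (j : K ⟶ X), j ≫ u = 0 → j ≫ q = 0) :
    ∃ g : image u ⟶ W, factorThruImage u ≫ g = q := by
  have hu : kernel.ι (factorThruImage u) ≫ u = 0 := by
    have := kernel.condition_assoc (factorThruImage u) (image.ι u)
    rwa [image.fac, zero_comp] at this
  have hk : kernel.ι (factorThruImage u) ≫ q = 0 := h _ _ hu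
  exact ⟨Abelian.epiDesc _ q hk, Abelian.comp_epiDesc _ q hk⟩

lemma IsSubquotient.of_shortExact {S : ShortComplex C} (hS : S.ShortExact) {T : C} [Simple T]
    (h : IsSubquotient T S.X₂) : IsSubquotient T S.X₁ ∨ IsSubquotient T S.X₃ := by
  obtain ⟨W, i, p, _, _⟩ := h
  have := hS.mono_f
  by_cases h₁ : pullback.fst i S.f ≫ p = 0
  · right
    obtain ⟨g, hg⟩ : ∃ g : image (i ≫ S.g) ⟶ T, factorThruImage (i ≫ S.g) ≫ g = p := by
      refine exists_factorThruImage_comp_eq fun K j hj => ?_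
      have hji : (j ≫ i) ≫ S.g = 0 := by rw [Category.assoc, hj]
      rw [← pullback.lift_fst j (hS.exact.lift _ hji) (hS.exact.lift_f _ hji).symm,
        Category.assoc, h₁, comp_zero]
    exact ⟨_, image.ι (i ≫ S.g), g, inferInstance, epi_of_epi_fac hg⟩
  · left
    exact ⟨_, pullback.snd i S.f, pullback.fst i S.f ≫ p, inferInstance,
      epi_of_nonzero_to_simple h₁⟩

lemma IsSubquotient.nonempty_iso {T S : C} [Simple T] [Simple S] (h : IsSubquotient T S) :
    Nonempty (T ≅ S) := by
  obtain ⟨Z, i, p, _, _⟩ := h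
  have hi : i ≠ 0 := by
    rintro rfl
    exact Simple.not_isZero T ((IsZero.of_mono_zero Z S).of_epi p)
  have := isIso_of_mono_of_nonzero hi
  have : Simple Z := Simple.of_iso (asIso i)
  have hp : p ≠ 0 := by
    rintro rfl
    exact Simple.not_isZero T (IsZero.of_epi_zero Z T)
  have := isIso_of_epi_of_nonzero hp
  exact ⟨(asIso p).symm ≪≫ asIso i⟩

end Subquotient

section CompositionFactors

variable {C : Type u} [Category.{v} C] [Abelian C]

lemma nontrivial_subobject_cokernel_of_lt {X : C} {a b : Subobject X} (h : a < b) :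
    Nontrivial (Subobject (cokernel (Subobject.ofLE a b h.le))) := by
  refine Subobject.nontrivial_of_not_isZero fun h0 => h.not_ge ?_
  have : Epi (Subobject.ofLE a b h.le) := Preadditive.epi_of_isZero_cokernel _ h0
  exact (isIso_ofLE_iff h.le).1 (isIso_of_mono_of_epi _)

lemma simple_cokernel_of_covBy {X : C} {a b : Subobject X} (h : a ⋖ b) :
    Simple (cokernel (Subobject.ofLE a b h.le)) := by
  let π := cokernel.π (Subobject.ofLE a b h.le)
  let F : Subobject (cokernel (Subobject.ofLE a b h.le)) → Subobject X := fun Q =>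
    (Subobject.map b.arrow).obj ((Subobject.pullback π).obj Q)
  have hF : StrictMono F :=
    (subobject_map_strictMono b.arrow).comp (subobject_pullback_strictMono π)
  have le_F : ∀ Q, a ≤ F Q := fun Q => Subobject.le_of_factors <| by
    rw [← Subobject.ofLE_arrow h.le, subobject_map_factors_comp_iff,
      subobject_pullback_factors_iff, cokernel.condition]
    exact Subobject.factors_zero
  have F_le : ∀ Q, F Q ≤ b := fun Q => by
    have := (Subobject.map b.arrow).monotone (le_top : (Subobject.pullback π).obj Q ≤ ⊤)
    rwa [Subobject.map_top, Subobject.mk_arrow] at this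
  have := nontrivial_subobject_cokernel_of_lt h.lt
  have : IsSimpleOrder (Subobject (cokernel (Subobject.ofLE a b h.le))) := ⟨fun Q => by
    by_contra! hQ
    exact h.2 ((le_F ⊥).trans_lt (hF hQ.1.bot_lt)) ((hF hQ.2.lt_top).trans_le (F_le ⊤))⟩
  exact simple_of_isSimpleOrder_subobject _

/-- The relation `P ≤ P'` with `P'/P` simple, between subobjects of `X`. Composition series are
chains for this relation, which can then be concatenated as `RelSeries`. -/
def simpleStep (X : C) : SetRel (Subobject X) (Subobject X) :=
  {p | ∃ h : p.1 ≤ p.2, Simple (cokernel (Subobject.ofLE p.1 p.2 h))}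

lemma exists_simpleStep_series {X : C} (hX : IsFiniteLength X) {a b : Subobject X} (h : a ≤ b) :
    ∃ s : RelSeries (simpleStep X), s.head = a ∧ s.last = b := by
  obtain ⟨_, _⟩ := (isFiniteLength_iff _).1 hX
  obtain ⟨f, h0, n, hn, hf⟩ := exists_covBy_seq_of_wellFoundedLT_wellFoundedGT_of_le h
  exact ⟨⟨n, fun i => f i, fun i => ⟨(hf i i.2).le, simple_cokernel_of_covBy (hf i i.2)⟩⟩, h0, hn⟩

/-- A chain for `simpleStep` from `0` to `X`, viewed as a composition series of `X`. -/
def CompSeries.ofRelSeries {X : C} (s : RelSeries (simpleStep X)) (h₀ : s.head = ⊥)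
    (h₁ : s.last = ⊤) : CompSeries X where
  length := s.length
  sub := s.toFun
  sub_zero := h₀
  sub_last := h₁
  le_succ i := (s.step i).1
  simple i := (s.step i).2

lemma isCompositionFactor_cokernel_ofLE {X : C} (hX : IsFiniteLength X) {Y Z : Subobject X}
    (h : Y ≤ Z) [hYZ : Simple (cokernel (Subobject.ofLE Y Z h))] :
    IsCompositionFactor (cokernel (Subobject.ofLE Y Z h)) X := by
  obtain ⟨s, hs₀, rfl⟩ := exists_simpleStep_series hX (bot_le : ⊥ ≤ Y)
  obtain ⟨t, rfl, ht₁⟩ := exists_simpleStep_series hX (le_top : Z ≤ ⊤)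
  have hst : (s.last, t.head) ∈ simpleStep X := ⟨h, hYZ⟩
  let r := s.append t hst
  have hr : ∀ (a b : Subobject X) (hab : a ≤ b), s.last = a → t.head = b →
      Nonempty (cokernel (Subobject.ofLE _ _ h) ≅ cokernel (Subobject.ofLE a b hab)) := by
    rintro _ _ _ rfl rfl
    exact ⟨Iso.refl _⟩
  refine ⟨CompSeries.ofRelSeries r (by simp [r, hs₀]) (by simp [r, ht₁]),
    ⟨s.length, by simp [CompSeries.ofRelSeries, r]⟩, hr _ _ _ ?_ ?_⟩
  · exact (Fin.append_left s t (Fin.last _)).symm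
  · exact (Fin.append_right s t 0).symm

lemma IsCompositionFactor.of_iso {S S' X : C} (e : S ≅ S') (h : IsCompositionFactor S' X) :
    IsCompositionFactor S X := by
  obtain ⟨s, i, ⟨e'⟩⟩ := h
  exact ⟨s, i, ⟨e ≪≫ e'⟩⟩

lemma IsSubquotient.isCompositionFactor {S X : C} [Simple S] (hX : IsFiniteLength X)
    (h : IsSubquotient S X) : IsCompositionFactor S X := by
  obtain ⟨W, i, p, _, _⟩ := h
  have hle : Subobject.mk (kernel.ι p ≫ i) ≤ Subobject.mk i :=
    Subobject.mk_le_mk_of_comm (kernel.ι p) rfl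
  have hofLE : Subobject.ofLE _ _ hle ≫ (Subobject.underlyingIso i).hom =
      (Subobject.underlyingIso (kernel.ι p ≫ i)).hom ≫ kernel.ι p := by
    rw [← cancel_mono i]
    simp
  let e : cokernel (Subobject.ofLE _ _ hle) ≅ S :=
    cokernel.mapIso _ (kernel.ι p) _ _ hofLE ≪≫
      (colimit.isColimit _).coconePointUniqueUpToIso
        (Abelian.epiIsCokernelOfKernel _ (limit.isLimit (parallelPair p 0)))
  have : Simple (cokernel (Subobject.ofLE _ _ hle)) := Simple.of_iso e
  exact .of_iso e.symm (isCompositionFactor_cokernel_ofLE hX hle)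

lemma IsCompositionFactor.simple {S X : C} (h : IsCompositionFactor S X) : Simple S := by
  obtain ⟨s, i, ⟨e⟩⟩ := h
  have : Simple (s.factor i) := s.simple i
  exact Simple.of_iso e

lemma IsCompositionFactor.isSubquotient {S X : C} (h : IsCompositionFactor S X) :
    IsSubquotient S X := by
  obtain ⟨s, i, ⟨e⟩⟩ := h
  refine IsSubquotient.of_epi ?_ e.inv
  exact ⟨_, (s.sub i.succ).arrow, (cokernel.π _ : _ ⟶ s.factor i), inferInstance,
    inferInstanceAs (Epi (cokernel.π _))⟩

lemma isCompositionFactor_iff {S X : C} (hX : IsFiniteLength X) :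
    IsCompositionFactor S X ↔ Simple S ∧ IsSubquotient S X :=
  ⟨fun h => ⟨h.simple, h.isSubquotient⟩, fun ⟨_, h⟩ => h.isCompositionFactor hX⟩

end CompositionFactors

section SerreClass

variable {C : Type u} [Category.{v} C] [Abelian C]

/-- The class of objects of finite length all of whose simple subquotients satisfy `R`. It is a
Serre class, so that membership can be checked by dévissage. -/
def finiteLengthWithFactors (R : C → Prop) : ObjectProperty C := fun X =>
  IsFiniteLength X ∧ ∀ S : C, Simple S → IsSubquotient S X → R S

instance (R : C → Prop) : (finiteLengthWithFactors R).IsSerreClass where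
  exists_zero := by
    open ZeroObject in
    refine ⟨(0 : C), isZero_zero C, ⟨isArtinianObject_of_isZero (isZero_zero C),
      isNoetherianObject_of_isZero (isZero_zero C)⟩, fun S _ hS => ?_⟩
    obtain ⟨Z, i, p, _, _⟩ := hS
    exact (Simple.not_isZero S (((isZero_zero C).of_mono i).of_epi p)).elim
  prop_of_mono f _ h := ⟨h.1.of_mono f, fun S hS hSX => h.2 S hS (hSX.of_mono f)⟩
  prop_of_epi f _ h := ⟨h.1.of_epi f, fun S hS hSX => h.2 S hS (hSX.of_epi_right f)⟩
  prop_X₂_of_shortExact hS h₁ h₃ := ⟨.of_shortExact hS h₁.1 h₃.1, fun T hT hTX =>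
    (IsSubquotient.of_shortExact hS hTX).elim (h₁.2 T hT) (h₃.2 T hT)⟩

lemma finiteLengthWithFactors_of_simple {R : C → Prop} {S : C} [Simple S]
    (hR : ∀ T : C, Nonempty (T ≅ S) → R T) : finiteLengthWithFactors R S :=
  ⟨isFiniteLength_of_simple S, fun T _ hT => hR T hT.nonempty_iso⟩

variable (P : ObjectProperty C) [P.IsSerreClass]

attribute [local instance] Abelian.hasFiniteBiproducts

lemma prop_biproduct {ι : Type*} [Finite ι] {Z : ι → C} (hZ : ∀ i, P (Z i)) : P (⨁ Z) := by
  have : P.IsClosedUnderBinaryProducts := ⟨by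
    rintro X ⟨p⟩
    exact P.prop_of_iso (((BinaryBiproduct.isLimit _ _).conePointUniqueUpToIso
      ((IsLimit.postcomposeHomEquiv (diagramIsoPair p.diag) _).2 p.isLimit)))
      (P.prop_biprod (p.prop_diag_obj (.mk .left)) (p.prop_diag_obj (.mk .right)))⟩
  have : P.IsClosedUnderFiniteProducts := .mk'
  exact P.prop_of_iso (biproduct.isoProduct Z).symm (P.prop_product hZ)

lemma prop_of_family_from {ι : Type*} [Finite ι] {Z : ι → C} (hZ : ∀ i, P (Z i)) {X : C}
    (f : ∀ i, Z i ⟶ X) (h : ∀ (T : C) (g : X ⟶ T), Epi g → (∀ i, f i ≫ g = 0) → P T) : P X := by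
  refine P.prop_X₂_of_exact (ShortComplex.exact_cokernel (biproduct.desc f)) (prop_biproduct P hZ)
    (h _ (cokernel.π (biproduct.desc f)) inferInstance fun i => ?_)
  rw [← biproduct.ι_desc f i, Category.assoc, cokernel.condition, comp_zero]

lemma prop_of_family_to {ι : Type*} [Finite ι] {Z : ι → C} (hZ : ∀ i, P (Z i)) {X W : C}
    (f : ∀ i, X ⟶ Z i) (q : X ⟶ W) [Epi q]
    (h : ∀ (K : C) (j : K ⟶ X), (∀ i, j ≫ f i = 0) → j ≫ q = 0) : P W := by
  obtain ⟨g, hg⟩ := exists_factorThruImage_comp_eq (u := biproduct.lift f) (q := q) fun K j hj =>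
    h K j fun i => by rw [← biproduct.lift_π f i, ← Category.assoc, hj, zero_comp]
  have : Epi g := epi_of_epi_fac hg
  exact P.prop_of_epi g (P.prop_of_mono (image.ι _) (prop_biproduct P hZ))

end SerreClass

/-! ### Additive functors and their subfunctors -/

variable {𝒜 : Type u} [Category.{v} 𝒜] [Preadditive 𝒜]

section Hom

variable {A B : 𝒜 ⥤+ AddCommGrpCat.{w}}

/-- The morphism of additive functors given by a natural family of additive maps. -/
def addHomMk (φ : ∀ a, A.obj.obj a →+ B.obj.obj a)
    (h : ∀ {a b : 𝒜} (f : a ⟶ b) (x : A.obj.obj a),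
      φ b ((A.obj.map f).hom x) = (B.obj.map f).hom (φ a x)) : A ⟶ B :=
  ObjectProperty.homMk
    { app a := AddCommGrpCat.ofHom (φ a)
      naturality a b f := by
        ext x
        exact h f x }

lemma addHom_ext {f g : A ⟶ B} (h : ∀ a x, (f.hom.app a).hom x = (g.hom.app a).hom x) : f = g := by
  apply ObjectProperty.hom_ext
  ext a x
  exact h a x

lemma addHom_congr {f g : A ⟶ B} (h : f = g) (a : 𝒜) (x : A.obj.obj a) :
    (f.hom.app a).hom x = (g.hom.app a).hom x := by rw [h]

lemma addHom_naturality (φ : A ⟶ B) {a b : 𝒜} (f : a ⟶ b) (x : A.obj.obj a) :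
    (φ.hom.app b).hom ((A.obj.map f).hom x) = (B.obj.map f).hom ((φ.hom.app a).hom x) :=
  ConcreteCategory.congr_hom (φ.hom.naturality f) x

lemma addHom_mono_of_injective (φ : A ⟶ B)
    (h : ∀ a, Function.Injective (φ.hom.app a).hom) : Mono φ :=
  ⟨fun _ _ hfg => addHom_ext fun a x => h a (addHom_congr hfg a x)⟩

lemma addHom_epi_of_surjective (φ : A ⟶ B)
    (h : ∀ a, Function.Surjective (φ.hom.app a).hom) : Epi φ :=
  ⟨fun _ _ hfg => addHom_ext fun a x => by
    obtain ⟨y, rfl⟩ := h a x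
    exact addHom_congr hfg a y⟩

lemma map_comp_apply {a b c : 𝒜} (f : a ⟶ b) (g : b ⟶ c) (x : A.obj.obj a) :
    (A.obj.map (f ≫ g)).hom x = (A.obj.map g).hom ((A.obj.map f).hom x) := by
  simp

lemma map_id_apply (a : 𝒜) (x : A.obj.obj a) : (A.obj.map (𝟙 a)).hom x = x := by
  simp

lemma map_add_apply {a b : 𝒜} (f g : a ⟶ b) (x : A.obj.obj a) :
    (A.obj.map (f + g)).hom x = (A.obj.map f).hom x + (A.obj.map g).hom x := by
  simp [A.obj.map_add]

end Hom

namespace AddSubfunctor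

variable {A : 𝒜 ⥤+ AddCommGrpCat.{w}}

lemma obj_injective : Function.Injective (obj : AddSubfunctor A → _) := by
  rintro ⟨_, _⟩ ⟨_, _⟩ h
  simpa using h

instance : PartialOrder (AddSubfunctor A) := PartialOrder.lift obj obj_injective

instance : OrderBot (AddSubfunctor A) where
  bot := ⟨fun _ => ⊥, by simp⟩
  bot_le _ _ := bot_le

instance : OrderTop (AddSubfunctor A) where
  top := ⟨fun _ => ⊤, by simp⟩
  le_top _ _ := le_top

@[simp] lemma bot_obj (a : 𝒜) : (⊥ : AddSubfunctor A).obj a = ⊥ := rfl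

@[simp] lemma top_obj (a : 𝒜) : (⊤ : AddSubfunctor A).obj a = ⊤ := rfl

lemma isProper_iff {B : AddSubfunctor A} : B.IsProper ↔ B < ⊤ := by
  rw [lt_top_iff_ne_top, IsProper, Ne, ← obj_injective.eq_iff, funext_iff, not_forall]
  rfl

lemma isNonzero_iff {B : AddSubfunctor A} : B.IsNonzero ↔ ⊥ < B := by
  rw [bot_lt_iff_ne_bot, IsNonzero, Ne, ← obj_injective.eq_iff, funext_iff, not_forall]
  rfl

/-- A subfunctor, as an additive functor in its own right. -/
def toFunctor (B : AddSubfunctor A) : 𝒜 ⥤+ AddCommGrpCat.{w} where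
  obj :=
    { obj a := AddCommGrpCat.of (B.obj a)
      map {a b} f := AddCommGrpCat.ofHom
        (((A.obj.map f).hom.comp (B.obj a).subtype).codRestrict (B.obj b)
          fun x => B.map_mem f x.2)
      map_id a := AddCommGrpCat.hom_ext (AddMonoidHom.ext fun x =>
        Subtype.ext (map_id_apply a x.1))
      map_comp f g := AddCommGrpCat.hom_ext (AddMonoidHom.ext fun x =>
        Subtype.ext (map_comp_apply f g x.1)) }
  property := ⟨fun {_ _ f g} => AddCommGrpCat.hom_ext (AddMonoidHom.ext fun x =>
    Subtype.ext (map_add_apply f g x.1))⟩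

/-- The inclusion of a subfunctor. -/
def ι (B : AddSubfunctor A) : B.toFunctor ⟶ A :=
  addHomMk (fun a => (B.obj a).subtype) fun _ _ => rfl

instance (B : AddSubfunctor A) : Mono B.ι :=
  addHom_mono_of_injective _ fun _ => Subtype.val_injective

/-- The quotient of an additive functor by a subfunctor. -/
def quot (B : AddSubfunctor A) : 𝒜 ⥤+ AddCommGrpCat.{w} where
  obj :=
    { obj a := AddCommGrpCat.of (A.obj.obj a ⧸ B.obj a)
      map {a b} f := AddCommGrpCat.ofHom
        (QuotientAddGroup.map (B.obj a) (B.obj b) (A.obj.map f).hom fun _ hx => B.map_mem f hx)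
      map_id a := AddCommGrpCat.hom_ext (QuotientAddGroup.addMonoidHom_ext _
        (AddMonoidHom.ext fun x => congrArg QuotientAddGroup.mk (map_id_apply a x)))
      map_comp f g := AddCommGrpCat.hom_ext (QuotientAddGroup.addMonoidHom_ext _
        (AddMonoidHom.ext fun x => congrArg QuotientAddGroup.mk (map_comp_apply f g x))) }
  property := ⟨fun {_ _ f g} => AddCommGrpCat.hom_ext (QuotientAddGroup.addMonoidHom_ext _
    (AddMonoidHom.ext fun x => congrArg QuotientAddGroup.mk (map_add_apply f g x)))⟩

/-- The projection to the quotient by a subfunctor. -/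
def π (B : AddSubfunctor A) : A ⟶ B.quot :=
  addHomMk (fun a => QuotientAddGroup.mk' (B.obj a)) fun _ _ => rfl

lemma π_surjective (B : AddSubfunctor A) (a : 𝒜) : Function.Surjective (B.π.hom.app a).hom :=
  QuotientAddGroup.mk'_surjective _

/-- The image of a morphism of additive functors. -/
def range {Z : 𝒜 ⥤+ AddCommGrpCat.{w}} (φ : Z ⟶ A) : AddSubfunctor A where
  obj a := (φ.hom.app a).hom.range
  map_mem {a b} f {x} hx := by
    obtain ⟨y, rfl⟩ := hx
    exact ⟨(Z.obj.map f).hom y, addHom_naturality φ f y⟩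

/-- The kernel of a morphism of additive functors. -/
def ker {Z : 𝒜 ⥤+ AddCommGrpCat.{w}} (φ : A ⟶ Z) : AddSubfunctor A where
  obj a := (φ.hom.app a).hom.ker
  map_mem {a b} f {x} hx := by
    rw [AddMonoidHom.mem_ker] at hx ⊢
    rw [addHom_naturality, hx, map_zero]

lemma mem_range {Z : 𝒜 ⥤+ AddCommGrpCat.{w}} {φ : Z ⟶ A} {a : 𝒜} {x : A.obj.obj a} :
    x ∈ (range φ).obj a ↔ ∃ y, (φ.hom.app a).hom y = x := Iff.rfl

end AddSubfunctor

section MonoEpi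

variable {A B : 𝒜 ⥤+ AddCommGrpCat.{w}}

lemma addHom_injective_of_mono (φ : A ⟶ B) [Mono φ] (a : 𝒜) :
    Function.Injective (φ.hom.app a).hom := by
  have h : (AddSubfunctor.ker φ).ι = addHomMk (fun a => 0) (by simp) := by
    rw [← cancel_mono φ]
    refine addHom_ext fun b x => ?_
    exact (AddMonoidHom.mem_ker.1 x.2).trans (map_zero (φ.hom.app b).hom).symm
  refine (injective_iff_map_eq_zero _).2 fun x hx => ?_
  exact addHom_congr h a (⟨x, hx⟩ : (AddSubfunctor.ker φ).obj a)

lemma addHom_surjective_of_epi (φ : A ⟶ B) [Epi φ] (a : 𝒜) :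
    Function.Surjective (φ.hom.app a).hom := by
  have h : (AddSubfunctor.range φ).π = addHomMk (fun a => 0) (by simp) := by
    rw [← cancel_epi φ]
    refine addHom_ext fun b x => ?_
    exact (QuotientAddGroup.eq_zero_iff _).2 ⟨x, rfl⟩
  intro x
  exact (QuotientAddGroup.eq_zero_iff _).1
    (addHom_congr h a x)

lemma exists_addHom_factor {Z : 𝒜 ⥤+ AddCommGrpCat.{w}} (φ : A ⟶ B) [Mono φ] (ψ : Z ⟶ B)
    (h : AddSubfunctor.range ψ ≤ AddSubfunctor.range φ) : ∃ l : Z ⟶ A, l ≫ φ = ψ := by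
  have hinj := addHom_injective_of_mono φ
  choose l hl using fun (a : 𝒜) (z : Z.obj.obj a) => AddSubfunctor.mem_range.1 (h a ⟨z, rfl⟩)
  refine ⟨addHomMk (fun a => AddMonoidHom.mk' (l a) fun x y => hinj a ?_) fun {a b} f x =>
    hinj b ?_, addHom_ext hl⟩
  · rw [map_add, hl, hl, hl, map_add]
  · simp only [AddMonoidHom.mk'_apply]
    rw [hl, addHom_naturality, addHom_naturality, hl]

end MonoEpi

namespace AddSubfunctor

variable {A : 𝒜 ⥤+ AddCommGrpCat.{w}}

lemma range_ι (B : AddSubfunctor A) : range B.ι = B :=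
  obj_injective (funext fun a => (B.obj a).range_subtype)

lemma mk_ι_le_iff {B B' : AddSubfunctor A} :
    Subobject.mk B.ι ≤ Subobject.mk B'.ι ↔ B ≤ B' := by
  constructor
  · intro h a x hx
    have := addHom_congr (Subobject.ofMkLEMk_comp h) a (⟨x, hx⟩ : B.obj a)
    change _ = x at this
    rw [← this]
    exact Subtype.prop (p := fun x => x ∈ B'.obj a) _
  · intro h
    obtain ⟨l, hl⟩ := exists_addHom_factor B'.ι B.ι (by rwa [range_ι, range_ι])
    exact Subobject.mk_le_mk_of_comm l hl

lemma range_arrow_strictMono :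
    StrictMono fun P : Subobject A => range P.arrow := by
  intro P P' h
  refine lt_of_le_not_ge ?_ fun h' => h.not_ge ?_
  · rintro a _ ⟨x, rfl⟩
    exact ⟨((Subobject.ofLE P P' h.le).hom.app a).hom x,
      addHom_congr (Subobject.ofLE_arrow h.le) a x⟩
  · obtain ⟨l, hl⟩ := exists_addHom_factor P.arrow P'.arrow h'
    exact Subobject.le_of_comm l hl

lemma isFiniteLength_iff : IsFiniteLength A ↔
    WellFoundedLT (AddSubfunctor A) ∧ WellFoundedGT (AddSubfunctor A) := by
  constructor
  · intro h
    obtain ⟨_, _⟩ := (AddRepLin.isFiniteLength_iff A).1 h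
    have : StrictMono fun B : AddSubfunctor A => Subobject.mk B.ι :=
      strictMono_of_le_iff_le fun _ _ => mk_ι_le_iff.symm
    exact ⟨this.wellFoundedLT, this.wellFoundedGT⟩
  · rintro ⟨_, _⟩
    exact isFiniteLength_of_strictMono range_arrow_strictMono

section Presentation

variable {B : 𝒜 ⥤+ AddCommGrpCat.{w}} (Z : AddSubfunctor A) (p : Z.toFunctor ⟶ B)

/-- The inverse image in `A` of a subfunctor `W` of `B`, when `p : Z ⟶ B` presents `B` as a
subquotient of `A`. -/
def lift (W : AddSubfunctor B) : AddSubfunctor A where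
  obj a := ((W.obj a).comap (p.hom.app a).hom).map (Z.obj a).subtype
  map_mem {a b} f {x} hx := by
    obtain ⟨z, hz, rfl⟩ := hx
    refine ⟨(Z.toFunctor.obj.map f).hom z, ?_, rfl⟩
    exact (congrArg (· ∈ W.obj b) (addHom_naturality p f z)).mpr
      (W.map_mem f (AddSubgroup.mem_comap.1 hz))

variable {Z p}

lemma mem_lift {W : AddSubfunctor B} {a : 𝒜} {x : A.obj.obj a} :
    x ∈ (lift Z p W).obj a ↔ ∃ h : x ∈ Z.obj a,
      (p.hom.app a).hom (⟨x, h⟩ : Z.obj a) ∈ W.obj a := by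
  constructor
  · rintro ⟨z, hz, rfl⟩
    exact ⟨z.2, hz⟩
  · rintro ⟨h, hx⟩
    exact ⟨⟨x, h⟩, hx, rfl⟩

lemma lift_top : lift Z p ⊤ = Z :=
  obj_injective (funext fun a => AddSubgroup.ext fun x => by simp [mem_lift])

lemma lift_strictMono (hp : ∀ a, Function.Surjective (p.hom.app a).hom) :
    StrictMono (lift Z p) := by
  refine strictMono_of_le_iff_le fun W W' => ⟨fun h a x hx => ?_, fun h a y hy => ?_⟩
  · obtain ⟨hx, hx'⟩ := mem_lift.1 hx
    exact mem_lift.2 ⟨hx, h a hx'⟩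
  · obtain ⟨⟨z, hz⟩, rfl⟩ := hp a y
    exact (mem_lift.1 (h a (mem_lift.2 ⟨hz, hy⟩))).2

lemma lift_comp_π_bot (W : AddSubfunctor B) : lift Z (p ≫ W.π) ⊥ = lift Z p W := by
  refine obj_injective (funext fun a => AddSubgroup.ext fun x => ?_)
  simp only [mem_lift, bot_obj, AddSubgroup.mem_bot]
  exact exists_congr fun hx => QuotientAddGroup.eq_zero_iff _

variable (Z p) in
/-- The restriction of `p : Z ⟶ B` to the inverse image of a subfunctor `W` of `B`, which presents
`W` as a subquotient of `A`. -/
def liftMap (W : AddSubfunctor B) : (lift Z p W).toFunctor ⟶ W.toFunctor :=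
  addHomMk (fun a => ((p.hom.app a).hom.comp
      (AddSubgroup.inclusion fun _ hx => (mem_lift.1 hx).1)).codRestrict (W.obj a)
        fun x => (mem_lift.1 x.2).2)
    fun f x => Subtype.ext (addHom_naturality p f (⟨x.1, (mem_lift.1 x.2).1⟩ : Z.obj _))

lemma liftMap_surjective (hp : ∀ a, Function.Surjective (p.hom.app a).hom) (W : AddSubfunctor B)
    (a : 𝒜) : Function.Surjective ((liftMap Z p W).hom.app a).hom := by
  rintro ⟨w, hw⟩
  obtain ⟨⟨z, hz⟩, rfl⟩ := hp a w
  exact ⟨⟨z, mem_lift.2 ⟨hz, hw⟩⟩, rfl⟩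

lemma lift_liftMap_bot (W : AddSubfunctor B) : lift _ (liftMap Z p W) ⊥ = lift Z p ⊥ := by
  refine obj_injective (funext fun a => AddSubgroup.ext fun x => ?_)
  simp only [mem_lift, bot_obj, AddSubgroup.mem_bot]
  constructor
  · rintro ⟨⟨hx, _⟩, h0⟩
    exact ⟨hx, congrArg Subtype.val h0⟩
  · rintro ⟨hx, h0⟩
    exact ⟨⟨hx, by rw [h0]; exact zero_mem _⟩, Subtype.ext h0⟩

end Presentation

lemma subquotient_induction [WellFoundedLT (AddSubfunctor A)] [WellFoundedGT (AddSubfunctor A)]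
    (P : (𝒜 ⥤+ AddCommGrpCat.{w}) → Prop)
    (h : ∀ B, IsSubquotient B A → IsFiniteLength B →
      (∀ W : AddSubfunctor B, W.IsProper → P W.toFunctor) →
      (∀ W : AddSubfunctor B, W.IsNonzero → P W.quot) → P B) : P A := by
  -- A subquotient `Z/K` of `A` with `K ≤ Z` shrinks when `Z` decreases or `K` increases.
  suffices key : ∀ (s : (AddSubfunctor A)ᵒᵈ × AddSubfunctor A) (B : 𝒜 ⥤+ AddCommGrpCat.{w})
      (Z : AddSubfunctor A) (p : Z.toFunctor ⟶ B),
      (∀ a, Function.Surjective (p.hom.app a).hom) →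
      (OrderDual.toDual (lift Z p ⊥), Z) = s → P B from
    key _ A ⊤ (⊤ : AddSubfunctor A).ι (fun a x => ⟨⟨x, trivial⟩, rfl⟩) rfl
  intro s
  induction s using WellFoundedLT.induction with
  | ind s ih =>
    rintro B Z p hp rfl
    have hmono := lift_strictMono hp
    have hB : IsFiniteLength B := isFiniteLength_iff.2 ⟨hmono.wellFoundedLT, hmono.wellFoundedGT⟩
    have := addHom_epi_of_surjective p hp
    refine h B ⟨_, Z.ι, p, inferInstance, inferInstance⟩ hB (fun W hW => ?_) fun W hW => ?_
    · refine ih _ ?_ _ _ (liftMap Z p W) (liftMap_surjective hp W) rfl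
      rw [lift_liftMap_bot, Prod.mk_lt_mk_iff_right]
      exact (hmono (isProper_iff.1 hW)).trans_eq lift_top
    · refine ih _ ?_ _ Z (p ≫ W.π) (fun a => (W.π_surjective a).comp (hp a)) rfl
      rw [lift_comp_π_bot, Prod.mk_lt_mk_iff_left]
      exact hmono (isNonzero_iff.1 hW)

end AddSubfunctor

lemma IsSubquotient.isFiniteLength {A B : 𝒜 ⥤+ AddCommGrpCat.{w}} (h : IsSubquotient B A)
    (hA : IsFiniteLength A) : IsFiniteLength B := by
  obtain ⟨Z, i, p, _, _⟩ := h
  obtain ⟨_, _⟩ := AddSubfunctor.isFiniteLength_iff.1 (hA.of_mono i)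
  have hmono : StrictMono (AddSubfunctor.lift (⊤ : AddSubfunctor Z) (AddSubfunctor.ι ⊤ ≫ p)) :=
    AddSubfunctor.lift_strictMono fun a =>
      (addHom_surjective_of_epi p a).comp fun x => ⟨⟨x, trivial⟩, rfl⟩
  exact AddSubfunctor.isFiniteLength_iff.2 ⟨hmono.wellFoundedLT, hmono.wellFoundedGT⟩

/-! ### Generators of functors and their values -/

section Generators

variable {A : 𝒜 ⥤+ AddCommGrpCat.{w}}

/-- The map `𝒜(a, b) → A(b)`, `f ↦ A(f) x`, given by an element `x` of `A(a)`: the value at `b` of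
the morphism from a representable functor corresponding to `x` in Yoneda's lemma. -/
def act {a : 𝒜} (x : A.obj.obj a) (b : 𝒜) : (a ⟶ b) →+ A.obj.obj b :=
  AddMonoidHom.mk' (fun f => (A.obj.map f).hom x) fun f g => by simp [A.obj.map_add]

@[simp]
lemma act_apply {a : 𝒜} (x : A.obj.obj a) {b : 𝒜} (f : a ⟶ b) :
    act x b f = (A.obj.map f).hom x := rfl

/-- `x` generates `A`: it lies in no proper subfunctor, see `isGenerator_iff`. -/
def IsGenerator {a : 𝒜} (x : A.obj.obj a) : Prop := ∀ b, Function.Surjective (act x b)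

/-- The subfunctor generated by an element. -/
def AddSubfunctor.gen {a : 𝒜} (x : A.obj.obj a) : AddSubfunctor A where
  obj b := (act x b).range
  map_mem {b c} f {y} hy := by
    obtain ⟨g, rfl⟩ := hy
    exact ⟨g ≫ f, map_comp_apply g f x⟩

lemma AddSubfunctor.gen_le {a : 𝒜} {x : A.obj.obj a} {B : AddSubfunctor A} (hx : x ∈ B.obj a) :
    AddSubfunctor.gen x ≤ B := by
  rintro b _ ⟨f, rfl⟩
  exact B.map_mem f hx

lemma AddSubfunctor.self_mem_gen {a : 𝒜} (x : A.obj.obj a) :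
    x ∈ (AddSubfunctor.gen x).obj a :=
  ⟨𝟙 a, map_id_apply a x⟩

lemma isGenerator_iff {a : 𝒜} {x : A.obj.obj a} :
    IsGenerator x ↔ ∀ B : AddSubfunctor A, B.IsProper → x ∉ B.obj a := by
  constructor
  · rintro h B ⟨b, hb⟩ hx
    refine hb ((AddSubgroup.eq_top_iff' _).2 fun y => ?_)
    obtain ⟨f, rfl⟩ := h b y
    exact B.map_mem f hx
  · intro h b
    by_contra hb
    refine h (AddSubfunctor.gen x) ⟨b, fun hb' => hb ?_⟩ (AddSubfunctor.self_mem_gen x)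
    exact AddMonoidHom.range_eq_top.1 hb'

/-- `c` cogenerates `A`: nonzero elements of `A` are detected by morphisms to `c`. -/
def IsCogenerating (A : 𝒜 ⥤+ AddCommGrpCat.{w}) (c : 𝒜) : Prop :=
  ∀ (a : 𝒜) (x : A.obj.obj a), (∀ f : a ⟶ c, (A.obj.map f).hom x = 0) → x = 0

/-- The largest subfunctor whose value at `a` is contained in `H`. For `H = ⊥` it consists of the
elements killed by all morphisms to `a`. -/
def AddSubfunctor.largest {a : 𝒜} (H : AddSubgroup (A.obj.obj a)) : AddSubfunctor A where
  obj b := ⨅ f : b ⟶ a, H.comap (A.obj.map f).hom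
  map_mem {b c} f {x} hx := by
    simp only [AddSubgroup.mem_iInf, AddSubgroup.mem_comap] at hx ⊢
    intro g
    rw [← map_comp_apply]
    exact hx _

lemma AddSubfunctor.mem_largest {a b : 𝒜} {H : AddSubgroup (A.obj.obj a)} {x : A.obj.obj b} :
    x ∈ (AddSubfunctor.largest H).obj b ↔ ∀ f : b ⟶ a, (A.obj.map f).hom x ∈ H := by
  simp [largest, AddSubgroup.mem_iInf]

lemma AddSubfunctor.le_largest_iff {a : 𝒜} {H : AddSubgroup (A.obj.obj a)} {B : AddSubfunctor A} :
    B ≤ AddSubfunctor.largest H ↔ B.obj a ≤ H := by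
  refine ⟨fun h x hx => ?_, fun h b x hx => mem_largest.2 fun f => h (B.map_mem f hx)⟩
  rw [← map_id_apply a x]
  exact mem_largest.1 (h a hx) (𝟙 a)

lemma AddSubfunctor.largest_bot_le_of_split_mono {c c' : 𝒜} (i : c ⟶ c') [IsSplitMono i] :
    AddSubfunctor.largest (⊥ : AddSubgroup (A.obj.obj c')) ≤
      AddSubfunctor.largest (⊥ : AddSubgroup (A.obj.obj c)) := by
  refine fun b x hx => mem_largest.2 fun f => ?_
  have hf : f = (f ≫ i) ≫ retraction i := by simp
  rw [hf, map_comp_apply, AddSubgroup.mem_bot.1 (mem_largest.1 hx _), map_zero]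
  exact zero_mem _

lemma AddSubfunctor.IsNonzero.exists_mem {c : 𝒜} (hc : IsCogenerating A c) {B : AddSubfunctor A}
    (hB : B.IsNonzero) : ∃ x ∈ B.obj c, x ≠ 0 := by
  obtain ⟨a, ha⟩ := hB
  obtain ⟨⟨x, hx⟩, hx0⟩ := AddSubgroup.ne_bot_iff_exists_ne_zero.1 ha
  by_contra! h
  exact hx0 (Subtype.ext <| hc a x fun f => h _ (B.map_mem f hx))

variable [Nonempty 𝒜] [HasBinaryBiproducts 𝒜]

variable (A) in
lemma exists_isGenerator [WellFoundedGT (AddSubfunctor A)] :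
    ∃ (a : 𝒜) (x : A.obj.obj a), IsGenerator x := by
  let S : Set (AddSubfunctor A) := {B | ∃ (a : 𝒜) (x : A.obj.obj a), B = AddSubfunctor.gen x}
  obtain ⟨o⟩ := ‹Nonempty 𝒜›
  obtain ⟨_, ⟨a, x, rfl⟩, hmax⟩ := wellFounded_gt.has_min S ⟨_, o, 0, rfl⟩
  refine ⟨a, x, fun b y => ?_⟩
  let z := (A.obj.map (biprod.inl : a ⟶ a ⊞ b)).hom x + (A.obj.map biprod.inr).hom y
  have hx : (A.obj.map biprod.fst).hom z = x := by
    simp only [z, map_add, ← map_comp_apply]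
    simp
  have hy : (A.obj.map biprod.snd).hom z = y := by
    simp only [z, map_add, ← map_comp_apply]
    simp
  have hle : AddSubfunctor.gen x ≤ AddSubfunctor.gen z :=
    AddSubfunctor.gen_le ⟨biprod.fst, hx⟩
  have hge : AddSubfunctor.gen z ≤ AddSubfunctor.gen x :=
    not_lt_iff_le_imp_ge.1 (hmax _ ⟨_, z, rfl⟩) hle
  exact hge b ⟨biprod.snd, hy⟩

variable (A) in
lemma exists_isCogenerating [WellFoundedLT (AddSubfunctor A)] : ∃ c, IsCogenerating A c := by
  obtain ⟨o⟩ := ‹Nonempty 𝒜›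
  let undetected (c : 𝒜) : AddSubfunctor A :=
    AddSubfunctor.largest (⊥ : AddSubgroup (A.obj.obj c))
  obtain ⟨_, ⟨c, rfl⟩, hmin⟩ :=
    wellFounded_lt.has_min (Set.range undetected) ⟨_, o, rfl⟩
  refine ⟨c, fun a x hx => ?_⟩
  have hle : undetected (c ⊞ a) ≤ undetected c :=
    AddSubfunctor.largest_bot_le_of_split_mono biprod.inl
  have hge : undetected c ≤ undetected (c ⊞ a) :=
    not_lt_iff_le_imp_ge.1 (hmin _ ⟨_, rfl⟩) hle
  have hxa : x ∈ (undetected a).obj a :=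
    AddSubfunctor.largest_bot_le_of_split_mono biprod.inr a
      (hge a (AddSubfunctor.mem_largest.2 hx))
  exact AddSubgroup.mem_bot.1 (AddSubfunctor.le_largest_iff.1 le_rfl hxa)

end Generators

section Values

variable (k : Type w) [Field k]

/-- The values of `A` are finite groups, of order invertible in `k`. This is what remains of the
`k`-triviality of `𝒜` when only one functor `A` is considered. -/
def HasInvertibleValues (A : 𝒜 ⥤+ AddCommGrpCat.{w}) : Prop :=
  ∀ a, Finite (A.obj.obj a) ∧ IsUnit (Nat.card (A.obj.obj a) : k)

variable {k} {A B : 𝒜 ⥤+ AddCommGrpCat.{w}}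

lemma HasInvertibleValues.of_isSubquotient (hA : HasInvertibleValues k A)
    (hB : IsSubquotient B A) : HasInvertibleValues k B := by
  obtain ⟨Z, i, p, hi, hp⟩ := hB
  intro a
  have hi' := addHom_injective_of_mono i a
  have hp' := addHom_surjective_of_epi p a
  have := (hA a).1
  have := Finite.of_injective _ hi'
  refine ⟨Finite.of_surjective _ hp', isUnit_of_dvd_unit (Nat.cast_dvd_cast ?_) (hA a).2⟩
  exact (AddSubgroup.card_dvd_of_surjective _ hp').trans (AddSubgroup.card_dvd_of_injective _ hi')

lemma IsTrivialFor.hasInvertibleValues [Nonempty 𝒜] [HasBinaryBiproducts 𝒜]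
    (h𝒜 : IsTrivialFor k 𝒜) (hA : IsFiniteLength A) : HasInvertibleValues k A := by
  have := (AddSubfunctor.isFiniteLength_iff.1 hA).2
  obtain ⟨a, x, hx⟩ := exists_isGenerator A
  intro b
  have := (h𝒜 a b).1
  exact ⟨Finite.of_surjective _ (hx b), isUnit_of_dvd_unit
    (Nat.cast_dvd_cast (AddSubgroup.card_dvd_of_surjective _ (hx b))) (h𝒜 a b).2⟩

end Values

section Elements

variable (k : Type w) [Field k] (A : 𝒜 ⥤+ AddCommGrpCat.{w})

lemma properSum_eq_supported (a : 𝒜) :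
    properSum k A a = Finsupp.supported k k {y : A.obj.obj a | ¬ IsGenerator y} := by
  refine le_antisymm (iSup₂_le fun B hB => ?_) ?_
  · rw [Finsupp.range_lmapDomain, Submodule.span_le]
    rintro _ ⟨y, rfl⟩
    exact Finsupp.single_mem_supported k 1 fun hy => isGenerator_iff.1 hy B hB y.2
  · rw [Finsupp.supported_eq_span_single, Submodule.span_le]
    rintro _ ⟨y, hy, rfl⟩
    obtain ⟨B, hB, hyB⟩ : ∃ B : AddSubfunctor A, B.IsProper ∧ y ∈ B.obj a := by
      simpa [isGenerator_iff] using hy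
    exact Submodule.mem_iSup_of_mem B (Submodule.mem_iSup_of_mem hB
      ⟨Finsupp.single ⟨y, hyB⟩ 1, Finsupp.mapDomain_single⟩)

variable {k A}

lemma properSum_le_iff {a : 𝒜} {N : Submodule k (A.obj.obj a →₀ k)} :
    properSum k A a ≤ N ↔ ∀ y : A.obj.obj a, ¬ IsGenerator y → Finsupp.single y 1 ∈ N := by
  rw [properSum_eq_supported, Finsupp.supported_eq_span_single, Submodule.span_le,
    Set.image_subset_iff]
  rfl

variable {B : 𝒜 ⥤+ AddCommGrpCat.{w}}

lemma IsGenerator.hom_ext {a : 𝒜} {x : A.obj.obj a} (hx : IsGenerator x) {φ ψ : A ⟶ B}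
    (h : (φ.hom.app a).hom x = (ψ.hom.app a).hom x) : φ = ψ := by
  refine addHom_ext fun b y => ?_
  obtain ⟨f, rfl⟩ := hx b y
  rw [act_apply, addHom_naturality, addHom_naturality, h]

lemma IsGenerator.exists_hom {a : 𝒜} {x : A.obj.obj a} (hx : IsGenerator x) (y : B.obj.obj a)
    (h : ∀ (b : 𝒜) (f : a ⟶ b), (A.obj.map f).hom x = 0 → (B.obj.map f).hom y = 0) :
    ∃ φ : A ⟶ B, (φ.hom.app a).hom x = y := by
  let l : ∀ b, A.obj.obj b →+ B.obj.obj b := fun b =>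
    AddMonoidHom.liftOfSurjective (act x b) (hx b) ⟨act y b, fun f hf => h b f hf⟩
  have hl : ∀ (b : 𝒜) (f : a ⟶ b), l b ((A.obj.map f).hom x) = (B.obj.map f).hom y :=
    fun b f => AddMonoidHom.liftOfRightInverse_comp_apply (act x b) _ _
      ⟨act y b, fun f hf => h b f hf⟩ f
  refine ⟨addHomMk l fun {b c} f z => ?_, ?_⟩
  · obtain ⟨g, rfl⟩ := hx b z
    rw [act_apply, ← map_comp_apply, hl, hl, map_comp_apply]
  · have := hl a (𝟙 a)
    rwa [map_id_apply, map_id_apply] at this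

/-- `Aut(A)` acts on the values of `A`. -/
instance (a : 𝒜) : MulAction (Aut A) (A.obj.obj a) where
  smul α y := (α.hom.hom.app a).hom y
  one_smul _ := rfl
  mul_smul _ _ _ := rfl

lemma map_aut_smul {a b : 𝒜} (f : a ⟶ b) (α : Aut A) (y : A.obj.obj a) :
    (A.obj.map f).hom (α • y) = α • (A.obj.map f).hom y :=
  (addHom_naturality α.hom f y).symm

lemma IsGenerator.aut_smul {a : 𝒜} {z : A.obj.obj a} (hz : IsGenerator z) (α : Aut A) :
    IsGenerator (α • z) := by
  intro b y
  obtain ⟨f, hf⟩ := hz b (α⁻¹ • y)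
  exact ⟨f, by rw [act_apply, map_aut_smul, ← act_apply, hf, smul_inv_smul]⟩

lemma IsGenerator.eq_of_smul_eq {a : 𝒜} {z : A.obj.obj a} (hz : IsGenerator z) {α β : Aut A}
    (h : α • z = β • z) : α = β :=
  Iso.ext (hz.hom_ext h)

lemma IsGenerator.mem_orbit_of_forall [∀ b, Finite (A.obj.obj b)] {a : 𝒜} {x y : A.obj.obj a}
    (hx : IsGenerator x) (hy : IsGenerator y)
    (h : ∀ (b : 𝒜) (f : a ⟶ b), (A.obj.map f).hom x = 0 → (A.obj.map f).hom y = 0) :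
    y ∈ MulAction.orbit (Aut A) x := by
  obtain ⟨φ, hφ⟩ := hx.exists_hom y h
  have hsurj : ∀ b, Function.Surjective (φ.hom.app b).hom := fun b z => by
    obtain ⟨f, rfl⟩ := hy b z
    exact ⟨(A.obj.map f).hom x, by rw [addHom_naturality, hφ, act_apply]⟩
  obtain ⟨ψ, hψ⟩ := hy.exists_hom x fun b f hf => by
    refine Finite.injective_iff_surjective.2 (hsurj b) ?_
    rw [map_zero, addHom_naturality, hφ, hf]
  refine ⟨⟨φ, ψ, hx.hom_ext ?_, hy.hom_ext ?_⟩, hφ⟩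
  · change (ψ.hom.app a).hom ((φ.hom.app a).hom x) = x
    rw [hφ, hψ]
  · change (φ.hom.app a).hom ((ψ.hom.app a).hom y) = y
    rw [hψ, hφ]

/-- The subfunctor of the elements `f x`, for all `f` with `f y = 0`. When `x` and `y` are
generators it vanishes only if they lie in the same orbit of `Aut(A)`. -/
def annImage {a : 𝒜} (x y : A.obj.obj a) : AddSubfunctor A where
  obj b := (act y b).ker.map (act x b)
  map_mem {b c} f {z} hz := by
    obtain ⟨g, hg, rfl⟩ := hz
    have hg' : (A.obj.map g).hom y = 0 := hg
    refine ⟨g ≫ f, ?_, map_comp_apply g f x⟩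
    change (A.obj.map (g ≫ f)).hom y = 0
    rw [map_comp_apply, hg', map_zero]

lemma annImage_isNonzero [∀ b, Finite (A.obj.obj b)] {a : 𝒜} {x y : A.obj.obj a}
    (hx : IsGenerator x) (hy : IsGenerator y)
    (h : y ∉ MulAction.orbit (Aut A) x) : (annImage x y).IsNonzero := by
  by_contra h0
  simp only [AddSubfunctor.IsNonzero, not_exists, not_not] at h0
  refine h (MulAction.mem_orbit_symm.1 (hy.mem_orbit_of_forall hx fun b f hf => ?_))
  exact (AddSubgroup.eq_bot_iff_forall _).1 (h0 b) _ ⟨f, hf, rfl⟩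

end Elements

/-! ### Averaging translations -/

section Translation

variable {k G H : Type*} [Field k] [AddCommGroup G] [AddCommGroup H]

/-- The average of the translations by the elements `σ t`, acting on `k[G]`. -/
def translateAverage {T : Type*} [Fintype T] (σ : T → G) : (G →₀ k) →ₗ[k] (G →₀ k) :=
  (Fintype.card T : k)⁻¹ • ∑ t, Finsupp.lmapDomain k k (· + σ t)

lemma mapDomain_translateAverage {T : Type*} [Fintype T] (e : H →+ G) (σ : T → H)
    (u : H →₀ k) : Finsupp.mapDomain e (translateAverage σ u) =
      translateAverage (e ∘ σ) (Finsupp.mapDomain e u) := by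
  have h (t : T) : e ∘ (· + σ t) = (· + e (σ t)) ∘ e := funext fun x => map_add e x (σ t)
  simp only [translateAverage, LinearMap.smul_apply, LinearMap.sum_apply,
    Finsupp.lmapDomain_apply, Finsupp.mapDomain_smul, Finsupp.mapDomain_finsetSum,
    ← Finsupp.mapDomain_comp, h, Function.comp_apply]

lemma translateAverage_zero {T : Type*} [Fintype T] (hT : (Fintype.card T : k) ≠ 0)
    (u : G →₀ k) : translateAverage (0 : T → G) u = u := by
  have h (x : G →₀ k) : Finsupp.mapDomain (fun y => y) x = x := Finsupp.mapDomain_id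
  simp only [translateAverage, Pi.zero_apply, add_zero, h,
    Finsupp.lmapDomain_apply, Finset.sum_const, Finset.card_univ,
    ← Nat.cast_smul_eq_nsmul k, inv_smul_smul₀ hT]

lemma translateAverage_val_eq_zero (K : AddSubgroup G) [Fintype K] {ξ : G →₀ k}
    (h : Finsupp.mapDomain (QuotientAddGroup.mk' K) ξ = 0) :
    translateAverage (Subtype.val : K → G) ξ = 0 := by
  -- The sum of the translations by the elements of `K` factors through `k[G/K]`.
  let φ : (G ⧸ K →₀ k) →ₗ[k] (G →₀ k) := Finsupp.lsum k fun q =>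
    ∑ z : K, Finsupp.lsingle (Quotient.out q + z)
  have hφ : φ ∘ₗ Finsupp.lmapDomain k k (QuotientAddGroup.mk' K) =
      ∑ z : K, Finsupp.lmapDomain k k (· + (z : G)) := by
    ext y : 2
    let z₀ : K := ⟨-Quotient.out (QuotientAddGroup.mk' K y) + y,
      QuotientAddGroup.eq.1 (Quotient.out_eq _)⟩
    simp only [φ, LinearMap.comp_apply, Finsupp.lsingle_apply, Finsupp.lmapDomain_apply,
      Finsupp.mapDomain_single, Finsupp.lsum_single, LinearMap.sum_apply]
    rw [← Equiv.sum_comp (Equiv.addLeft z₀)]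
    refine Finset.sum_congr rfl fun z _ => ?_
    simp [z₀, ← add_assoc]
  rw [translateAverage, ← hφ, LinearMap.smul_apply, LinearMap.comp_apply,
    Finsupp.lmapDomain_apply, h, map_zero, smul_zero]

lemma exists_mapDomain_eq_and_forall_mapDomain_eq_zero [Finite G] (hG : (Nat.card G : k) ≠ 0)
    {e : H →+ G} (he : Function.Surjective e) {ι : Type*} {G' : ι → Type*}
    [∀ i, AddCommGroup (G' i)] (e' : ∀ i, H →+ G' i) (s : Finset ι) {ξ : G →₀ k}
    (hξ : ∀ i ∈ s, Finsupp.mapDomain (QuotientAddGroup.mk' ((e' i).ker.map e)) ξ = 0) :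
    ∃ u : H →₀ k, Finsupp.mapDomain e u = ξ ∧ ∀ i ∈ s, Finsupp.mapDomain (e' i) u = 0 := by
  classical
  induction s using Finset.induction_on with
  | empty =>
    obtain ⟨u, hu⟩ := Finsupp.mapDomain_surjective he ξ
    exact ⟨u, hu, by simp⟩
  | insert i s _ ih =>
    obtain ⟨u, hu, hu'⟩ := ih fun j hj => hξ j (Finset.mem_insert_of_mem hj)
    let K := (e' i).ker.map e
    have := Fintype.ofFinite K
    have hK : (Fintype.card K : k) ≠ 0 := fun h0 => by
      obtain ⟨m, hm⟩ := K.card_addSubgroup_dvd_card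
      exact hG (by rw [hm, Nat.card_eq_fintype_card, Nat.cast_mul, h0, zero_mul])
    choose σ hσ hσe using fun z : K => z.2
    -- Averaging over lifts to `ker (e' i)` kills `ξ` in `k[G]`, but does nothing in `k[G' i]`.
    have hv : Finsupp.mapDomain e (translateAverage σ u) = 0 := by
      rw [mapDomain_translateAverage, hu, show e ∘ σ = Subtype.val from funext hσe]
      exact translateAverage_val_eq_zero K (hξ i (Finset.mem_insert_self i s))
    have hvi : Finsupp.mapDomain (e' i) (translateAverage σ u) = Finsupp.mapDomain (e' i) u := by
      rw [mapDomain_translateAverage, show e' i ∘ σ = 0 from funext hσ, translateAverage_zero hK]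
    refine ⟨u - translateAverage σ u, ?_, fun j hj => ?_⟩
    · rw [Finsupp.mapDomain_sub, hu, hv, sub_zero]
    · rw [Finsupp.mapDomain_sub]
      rcases Finset.mem_insert.1 hj with rfl | hj
      · rw [hvi, sub_self]
      · rw [mapDomain_translateAverage, hu' j hj, map_zero, sub_zero]

end Translation

section Separation

variable {k : Type w} [Field k] {A : 𝒜 ⥤+ AddCommGrpCat.{w}}

lemma mem_quotKer_iff {a : 𝒜} {ξ : A.obj.obj a →₀ k} :
    ξ ∈ quotKer k A a ↔ ∀ B : AddSubfunctor A, B.IsNonzero →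
      Finsupp.mapDomain (QuotientAddGroup.mk' (B.obj a)) ξ = 0 := by
  simp only [quotKer, Submodule.mem_iInf, LinearMap.mem_ker, Finsupp.lmapDomain_apply]

lemma exists_mapDomain_act_eq_of_mem_quotKer (hA : HasInvertibleValues k A) {a b : 𝒜}
    {x : A.obj.obj a} (hx : IsGenerator x) {ξ : A.obj.obj b →₀ k} (hξ : ξ ∈ quotKer k A b) :
    ∃ u : (a ⟶ b) →₀ k, Finsupp.mapDomain (act x b) u = ξ ∧
      ∀ y : A.obj.obj a, IsGenerator y → y ∉ MulAction.orbit (Aut A) x →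
        Finsupp.mapDomain (act y b) u = 0 := by
  have hfin (c : 𝒜) : Finite (A.obj.obj c) := (hA c).1
  obtain ⟨s, hs⟩ := (Set.toFinite {y : A.obj.obj a | IsGenerator y ∧
    y ∉ MulAction.orbit (Aut A) x}).exists_finset
  obtain ⟨u, hu, hu'⟩ := exists_mapDomain_eq_and_forall_mapDomain_eq_zero (hA b).2.ne_zero
    (hx b) (act · b) s fun y hy => mem_quotKer_iff.1 hξ (annImage x y)
      (annImage_isNonzero hx ((hs y).1 hy).1 ((hs y).1 hy).2)
  exact ⟨u, hu, fun y hy hyx => hu' y ((hs y).2 ⟨hy, hyx⟩)⟩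

end Separation

section Nonvanishing

variable {k : Type w} [Field k] {A : 𝒜 ⥤+ AddCommGrpCat.{w}}

variable (k) in
/-- The value at `a` of the kernel of `k[A] → k[A/B]`. -/
def AddSubfunctor.linKer (B : AddSubfunctor A) (a : 𝒜) : Submodule k (A.obj.obj a →₀ k) :=
  LinearMap.ker (Finsupp.lmapDomain k k (QuotientAddGroup.mk' (B.obj a)))

lemma AddSubfunctor.mem_linKer {B : AddSubfunctor A} {a : 𝒜} {ξ : A.obj.obj a →₀ k} :
    ξ ∈ B.linKer k a ↔ Finsupp.mapDomain (QuotientAddGroup.mk' (B.obj a)) ξ = 0 :=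
  Iff.rfl

lemma AddSubfunctor.linKer_mono {B B' : AddSubfunctor A} (h : B ≤ B') (a : 𝒜) :
    B.linKer k a ≤ B'.linKer k a := fun ξ hξ => by
  have h' := lmapDomain_ker_le k _ (QuotientAddGroup.mk' (B'.obj a)) id
    (QuotientAddGroup.map (B.obj a) (B'.obj a) (AddMonoidHom.id _) (h a)) (fun _ => rfl) hξ
  rwa [Finsupp.lmapDomain_id, Submodule.comap_id] at h'

lemma mem_quotKer_iff_of_isCogenerating {c : 𝒜} (hc : IsCogenerating A c) {a : 𝒜}
    {ξ : A.obj.obj a →₀ k} :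
    ξ ∈ quotKer k A a ↔ ∀ y : A.obj.obj c, y ≠ 0 → ξ ∈ (AddSubfunctor.gen y).linKer k a := by
  rw [mem_quotKer_iff]
  constructor
  · intro h y hy
    exact h _ ⟨c, fun h0 => hy <| by simpa [h0] using AddSubfunctor.self_mem_gen y⟩
  · intro h B hB
    obtain ⟨y, hyB, hy⟩ := hB.exists_mem hc
    exact AddSubfunctor.linKer_mono (AddSubfunctor.gen_le hyB) a (h y hy)

variable [HasBinaryBiproducts 𝒜] {c d : 𝒜}

/-- The element `(t, y)` of `A(d ⊞ c) ≃ A(d) × A(c)`, as a function of `t`. -/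
def shift (y : A.obj.obj c) (t : A.obj.obj d) : A.obj.obj (d ⊞ c) :=
  (A.obj.map biprod.inl).hom t + (A.obj.map biprod.inr).hom y

@[simp]
lemma map_fst_shift (y : A.obj.obj c) (t : A.obj.obj d) :
    (A.obj.map biprod.fst).hom (shift y t) = t := by
  rw [shift, map_add, ← map_comp_apply, ← map_comp_apply]
  simp

@[simp]
lemma map_snd_shift (y : A.obj.obj c) (t : A.obj.obj d) :
    (A.obj.map biprod.snd).hom (shift y t) = y := by
  rw [shift, map_add, ← map_comp_apply, ← map_comp_apply]
  simp

lemma shift_injective (y : A.obj.obj c) : Function.Injective (shift (d := d) y) :=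
  Function.LeftInverse.injective (map_fst_shift y)

lemma IsGenerator.shift {y : A.obj.obj c} (hy : IsGenerator y) (t : A.obj.obj d) :
    IsGenerator (shift y t) := fun b z => by
  obtain ⟨f, rfl⟩ := hy b z
  exact ⟨biprod.snd ≫ f, by rw [act_apply, map_comp_apply, map_snd_shift, act_apply]⟩

lemma mapDomain_shift_mem_linKer {B : AddSubfunctor A} {ζ : A.obj.obj d →₀ k}
    (hζ : ζ ∈ B.linKer k d) (y : A.obj.obj c) :
    Finsupp.mapDomain (shift y) ζ ∈ B.linKer k (d ⊞ c) :=
  lmapDomain_ker_le k _ (QuotientAddGroup.mk' (B.obj (d ⊞ c))) (shift y)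
    (fun q => QuotientAddGroup.map (B.obj d) (B.obj (d ⊞ c)) (A.obj.map biprod.inl).hom
      (fun _ hx => B.map_mem _ hx) q + QuotientAddGroup.mk ((A.obj.map biprod.inr).hom y))
    (fun _ => rfl) hζ

lemma mapDomain_shift_mem_quotKer {ζ : A.obj.obj d →₀ k} (hζ : ζ ∈ quotKer k A d)
    (y : A.obj.obj c) : Finsupp.mapDomain (shift y) ζ ∈ quotKer k A (d ⊞ c) :=
  mem_quotKer_iff.2 fun B hB => mapDomain_shift_mem_linKer (mem_quotKer_iff.1 hζ B hB) y

lemma mapDomain_shift_sub_mem_linKer {B : AddSubfunctor A} {y : A.obj.obj c} (hy : y ∈ B.obj c)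
    (ζ : A.obj.obj d →₀ k) :
    Finsupp.mapDomain (shift y) ζ - Finsupp.mapDomain (shift 0) ζ ∈ B.linKer k (d ⊞ c) := by
  have h : QuotientAddGroup.mk' (B.obj (d ⊞ c)) ∘ shift y =
      QuotientAddGroup.mk' (B.obj (d ⊞ c)) ∘ shift 0 := by
    refine funext fun t => QuotientAddGroup.eq.2 ?_
    have hy' : -(A.obj.map biprod.inr).hom y ∈ B.obj (d ⊞ c) := neg_mem (B.map_mem _ hy)
    simpa [shift] using hy'
  rw [AddSubfunctor.mem_linKer, Finsupp.mapDomain_sub, ← Finsupp.mapDomain_comp, h,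
    Finsupp.mapDomain_comp, sub_self]

lemma mapDomain_shift_sub_ne_zero {y : A.obj.obj c} (hy : y ≠ 0) {ζ : A.obj.obj d →₀ k}
    (hζ : ζ ≠ 0) : Finsupp.mapDomain (shift y) ζ - Finsupp.mapDomain (shift 0) ζ ≠ 0 := by
  obtain ⟨t, ht⟩ := Finsupp.ne_iff.1 hζ
  refine Finsupp.ne_iff.2 ⟨shift y t, ?_⟩
  rw [Finsupp.sub_apply, Finsupp.mapDomain_apply (shift_injective y),
    Finsupp.mapDomain_of_notMem_range (f := shift 0), sub_zero]
  · exact ht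
  · rintro ⟨t', ht'⟩
    exact hy (by simpa using congrArg (A.obj.map biprod.snd).hom ht'.symm)

variable (k) in
lemma exists_ne_zero_forall_mem_linKer (s : Finset (A.obj.obj c)) (hs : ∀ y ∈ s, y ≠ 0) :
    ∃ (d : 𝒜) (ζ : A.obj.obj d →₀ k), ζ ≠ 0 ∧
      ∀ y ∈ s, ζ ∈ (AddSubfunctor.gen y).linKer k d := by
  classical
  induction s using Finset.induction_on with
  | empty => exact ⟨c, Finsupp.single 0 1, by simp, by simp⟩
  | insert y s _ ih =>
    obtain ⟨d, ζ, hζ0, hζ⟩ := ih fun z hz => hs z (Finset.mem_insert_of_mem hz)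
    refine ⟨d ⊞ c, Finsupp.mapDomain (shift y) ζ - Finsupp.mapDomain (shift 0) ζ,
      mapDomain_shift_sub_ne_zero (hs y (Finset.mem_insert_self y s)) hζ0, fun z hz => ?_⟩
    rcases Finset.mem_insert.1 hz with rfl | hz
    · exact mapDomain_shift_sub_mem_linKer (AddSubfunctor.self_mem_gen z) ζ
    · exact sub_mem (mapDomain_shift_mem_linKer (hζ z hz) y)
        (mapDomain_shift_mem_linKer (hζ z hz) 0)

variable (k) in
lemma exists_mem_quotKer_ne_zero (hc : IsCogenerating A c) [Finite (A.obj.obj c)] :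
    ∃ (d : 𝒜) (ζ : A.obj.obj d →₀ k), ζ ∈ quotKer k A d ∧ ζ ≠ 0 := by
  obtain ⟨s, hs⟩ := (Set.toFinite {y : A.obj.obj c | y ≠ 0}).exists_finset
  obtain ⟨d, ζ, hζ0, hζ⟩ := exists_ne_zero_forall_mem_linKer k s fun y hy => (hs y).1 hy
  exact ⟨d, ζ, (mem_quotKer_iff_of_isCogenerating hc).2 fun y hy => hζ y ((hs y).2 hy), hζ0⟩

end Nonvanishing

/-! ### Coordinates on `M ⊗ Q_A` -/

section Tensor

variable {k : Type w} [Field k] {A : 𝒜 ⥤+ AddCommGrpCat.{w}} (M : Rep.{w} k (Aut A))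

/-- The functor `M ⊗_{k[Aut(A)]} Q_A`. -/
def tensorLower : 𝒜 ⥤ ModuleCat.{w} k :=
  Qlower k A ⋙ (Rep.coinvariantsTensor k (Aut A)).obj M

/-- The functor `M ⊗_{k[Aut(A)]} Q^A`. -/
def tensorUpper : 𝒜 ⥤ ModuleCat.{w} k :=
  Qupper k A ⋙ (Rep.coinvariantsTensor k (Aut A)).obj M

/-- The canonical morphism `M ⊗_{k[Aut(A)]} Q^A ⟶ M ⊗_{k[Aut(A)]} Q_A`, with image `Q(A, M)`. -/
def tensorHom : tensorUpper M ⟶ tensorLower M :=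
  Functor.whiskerRight (QupperToQlower k A) ((Rep.coinvariantsTensor k (Aut A)).obj M)

/-- The class of `m ⊗ x` in `M ⊗_{k[Aut(A)]} Q_A(a)`, for `x` in `k[A(a)]`. -/
def tmk (a : 𝒜) : M →ₗ[k] (A.obj.obj a →₀ k) →ₗ[k] (tensorLower M).obj a :=
  (Rep.coinvariantsTensorMk M ((Qlower k A).obj a)).compl₂ (properSum k A a).mkQ

lemma linRep_single {a : 𝒜} (g : Aut A) (y : A.obj.obj a) (r : k) :
    linRep k A a g (Finsupp.single y r) = Finsupp.single (g • y) r :=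
  Finsupp.mapDomain_single

variable {M}

lemma tmk_act (a : 𝒜) (g : Aut A) (m : M) (x : A.obj.obj a →₀ k) :
    tmk M a (M.ρ g m) (linRep k A a g x) = tmk M a m x :=
  Representation.Coinvariants.mk_self_apply (M.ρ.tprod (QlowerRep k A a)) g
    (m ⊗ₜ[k] (properSum k A a).mkQ x)

lemma tmk_of_mem_properSum {a : 𝒜} (m : M) {x : A.obj.obj a →₀ k} (hx : x ∈ properSum k A a) :
    tmk M a m x = 0 := by
  have h : (properSum k A a).mkQ x = 0 := (Submodule.Quotient.mk_eq_zero _).2 hx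
  exact (congrArg (Rep.coinvariantsTensorMk M ((Qlower k A).obj a) m) h).trans (map_zero _)

lemma map_tmk {a b : 𝒜} (f : a ⟶ b) (m : M) (x : A.obj.obj a →₀ k) :
    ((tensorLower M).map f).hom (tmk M a m x) = tmk M b m (linMap k A f x) := rfl

lemma single_mem_properSum {a : 𝒜} {y : A.obj.obj a} (hy : ¬ IsGenerator y) (r : k) :
    Finsupp.single y r ∈ properSum k A a := by
  rw [← mul_one r, ← smul_eq_mul, ← Finsupp.smul_single]
  exact Submodule.smul_mem _ r (properSum_le_iff.1 le_rfl y hy)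

lemma submodule_tensorLower_eq_top {a : 𝒜} {N : Submodule k ((tensorLower M).obj a)}
    (h : ∀ m y, IsGenerator y → tmk M a m (Finsupp.single y 1) ∈ N) : N = ⊤ := by
  have hx (m : M) (x : A.obj.obj a →₀ k) : tmk M a m x ∈ N := by
    induction x using Finsupp.induction_linear with
    | zero => rw [map_zero]; exact N.zero_mem
    | add x y hx hy => rw [map_add]; exact N.add_mem hx hy
    | single y r =>
      by_cases hy : IsGenerator y
      · rw [← mul_one r, ← smul_eq_mul, ← Finsupp.smul_single, map_smul]
        exact N.smul_mem r (h m y hy)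
      · rw [tmk_of_mem_properSum m (single_mem_properSum hy r)]
        exact N.zero_mem
  refine (Submodule.eq_top_iff').2 fun t => ?_
  obtain ⟨t, rfl⟩ := Representation.Coinvariants.mk_surjective (M.ρ.tprod (QlowerRep k A a)) t
  induction t using TensorProduct.induction_on with
  | zero => exact N.zero_mem
  | add s t hs ht => exact N.add_mem hs ht
  | tmul m y =>
    obtain ⟨x, rfl⟩ := (properSum k A a).mkQ_surjective y
    exact hx m x

lemma tensorLower_hom_ext {a : 𝒜} {W : Type*} [AddCommGroup W] [Module k W]
    {f g : (tensorLower M).obj a →ₗ[k] W} (h : ∀ m y, IsGenerator y →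
      f (tmk M a m (Finsupp.single y 1)) = g (tmk M a m (Finsupp.single y 1))) : f = g :=
  LinearMap.eqLocus_eq_top.1 (submodule_tensorLower_eq_top h)

lemma range_tensorHom_le_iff {a : 𝒜} {N : Submodule k ((tensorLower M).obj a)} :
    LinearMap.range ((tensorHom M).app a).hom ≤ N ↔
      ∀ m : M, ∀ x ∈ quotKer k A a, tmk M a m x ∈ N := by
  constructor
  · intro h m x hx
    exact h ⟨Rep.coinvariantsTensorMk M ((Qupper k A).obj a) m (⟨x, hx⟩ : quotKer k A a), rfl⟩
  · rintro h _ ⟨t, rfl⟩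
    obtain ⟨t, rfl⟩ := Representation.Coinvariants.mk_surjective
      (M.ρ.tprod (QupperRep k A a)) t
    induction t using TensorProduct.induction_on with
    | zero => exact (congrArg (· ∈ N) (map_zero ((tensorHom M).app a).hom)).mpr N.zero_mem
    | add x y hx hy =>
      exact (congrArg (· ∈ N) (map_add ((tensorHom M).app a).hom _ _)).mpr (N.add_mem hx hy)
    | tmul m y => exact h m y.1 y.2

/-- The linear map on `M ⊗_{k[Aut(A)]} Q_A(a)` given by an equivariant family of linear maps on
`M`, indexed by `A(a)` and vanishing outside the generators. -/
def tensorLowerLift {a : 𝒜} {W : Type*} [AddCommGroup W] [Module k W]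
    (β : A.obj.obj a → M →ₗ[k] W) (hβ : ∀ (g : Aut A) y m, β (g • y) (M.ρ g m) = β y m)
    (hβ' : ∀ y, ¬ IsGenerator y → β y = 0) : (tensorLower M).obj a →ₗ[k] W :=
  Representation.Coinvariants.lift (M.ρ.tprod (QlowerRep k A a))
    (TensorProduct.lift ((properSum k A a).liftQ (Finsupp.linearCombination k β)
      (properSum_le_iff.2 fun y hy => by simp [hβ' y hy])).flip) fun g => by
    refine TensorProduct.ext (LinearMap.ext fun m => Submodule.linearMap_qext _
      (Finsupp.lhom_ext' fun y => LinearMap.ext_ring ?_))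
    change Finsupp.linearCombination k β (linRep k A a g (Finsupp.single y 1)) (M.ρ g m) =
      Finsupp.linearCombination k β (Finsupp.single y 1) m
    simp [linRep_single, hβ]

lemma tensorLowerLift_tmk {a : 𝒜} {W : Type*} [AddCommGroup W] [Module k W]
    (β : A.obj.obj a → M →ₗ[k] W) (hβ : ∀ (g : Aut A) y m, β (g • y) (M.ρ g m) = β y m)
    (hβ' : ∀ y, ¬ IsGenerator y → β y = 0) (m : M) (x : A.obj.obj a →₀ k) :
    tensorLowerLift β hβ hβ' (tmk M a m x) = Finsupp.linearCombination k β x m := rfl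

end Tensor

section Orbits

variable {k : Type w} [Field k] {A : 𝒜 ⥤+ AddCommGrpCat.{w}}
  {V : Type*} [AddCommGroup V] [Module k V] (ρ : Representation k (Aut A) V)

open Classical in
/-- The operator `ρ(α)⁻¹` if `y = α z`, and zero if `y` is not in the orbit of `z`. The
automorphism `α` is unique when `z` is a generator. -/
def orbitMap {a : 𝒜} (z y : A.obj.obj a) : V →ₗ[k] V :=
  if h : y ∈ MulAction.orbit (Aut A) z then ρ h.choose⁻¹ else 0

lemma orbitMap_smul {a : 𝒜} {z : A.obj.obj a} (hz : IsGenerator z) (α : Aut A) :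
    orbitMap ρ z (α • z) = ρ α⁻¹ := by
  have h : α • z ∈ MulAction.orbit (Aut A) z := MulAction.mem_orbit z α
  rw [orbitMap, dif_pos h, hz.eq_of_smul_eq h.choose_spec]

lemma orbitMap_self {a : 𝒜} {z : A.obj.obj a} (hz : IsGenerator z) :
    orbitMap ρ z z = LinearMap.id := by
  have h := orbitMap_smul ρ hz 1
  rwa [one_smul, inv_one, map_one] at h

lemma orbitMap_of_notMem_orbit {a : 𝒜} {z y : A.obj.obj a}
    (h : y ∉ MulAction.orbit (Aut A) z) : orbitMap ρ z y = 0 :=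
  dif_neg h

lemma orbitMap_of_not_isGenerator {a : 𝒜} {z y : A.obj.obj a} (hz : IsGenerator z)
    (hy : ¬ IsGenerator y) : orbitMap ρ z y = 0 :=
  orbitMap_of_notMem_orbit ρ fun ⟨α, hα⟩ => hy (hα ▸ hz.aut_smul α)

lemma orbitMap_smul_apply {a : 𝒜} {z : A.obj.obj a} (hz : IsGenerator z) (g : Aut A)
    (y : A.obj.obj a) (v : V) : orbitMap ρ z (g • y) (ρ g v) = orbitMap ρ z y v := by
  by_cases h : y ∈ MulAction.orbit (Aut A) z
  · obtain ⟨α, rfl⟩ := h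
    dsimp only
    rw [← mul_smul, orbitMap_smul ρ hz, orbitMap_smul ρ hz, mul_inv_rev, map_mul,
      Module.End.mul_apply, ρ.inv_self_apply]
  · have h' : g • y ∉ MulAction.orbit (Aut A) z := fun h' =>
      h (by simpa using MulAction.mem_orbit_of_mem_orbit g⁻¹ h')
    rw [orbitMap_of_notMem_orbit ρ h, orbitMap_of_notMem_orbit ρ h']
    rfl

variable {M : Rep.{w} k (Aut A)} {a : 𝒜} {z : A.obj.obj a}

/-- The coefficient in `M` of the generator `z`, for an element of `M ⊗_{k[Aut(A)]} Q_A(a)`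
written as a sum over representatives of the `Aut(A)`-orbits of generators, `z` being one of
them. -/
def orbitCoeff (hz : IsGenerator z) : (tensorLower M).obj a →ₗ[k] M :=
  tensorLowerLift (orbitMap M.ρ z) (orbitMap_smul_apply M.ρ hz)
    fun _ => orbitMap_of_not_isGenerator M.ρ hz

lemma orbitCoeff_tmk (hz : IsGenerator z) (m : M) (x : A.obj.obj a →₀ k) :
    orbitCoeff hz (tmk M a m x) = Finsupp.linearCombination k (orbitMap M.ρ z) x m :=
  tensorLowerLift_tmk _ _ _ m x

lemma orbitCoeff_tmk_single (hz : IsGenerator z) (m : M) (y : A.obj.obj a) :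
    orbitCoeff hz (tmk M a m (Finsupp.single y 1)) = orbitMap M.ρ z y m := by
  rw [orbitCoeff_tmk, Finsupp.linearCombination_single, one_smul]

lemma tmk_linRep (g : Aut A) (m : M) (x : A.obj.obj a →₀ k) :
    tmk M a m (linRep k A a g x) = tmk M a (M.ρ g⁻¹ m) x := by
  rw [← tmk_act a g (M.ρ g⁻¹ m), M.ρ.self_inv_apply]

lemma tmk_orbitMap_single (hz : IsGenerator z) {y : A.obj.obj a}
    (hy : y ∈ MulAction.orbit (Aut A) z) (m : M) :
    tmk M a (orbitMap M.ρ z y m) (Finsupp.single z 1) = tmk M a m (Finsupp.single y 1) := by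
  obtain ⟨α, rfl⟩ := hy
  dsimp only
  rw [orbitMap_smul M.ρ hz, ← tmk_linRep, linRep_single]

lemma exists_orbitCoeff_ne_zero [Finite (A.obj.obj a)] {t : (tensorLower M).obj a} (ht : t ≠ 0) :
    ∃ (z : A.obj.obj a) (hz : IsGenerator z), orbitCoeff hz t ≠ 0 := by
  let r : Setoid {y : A.obj.obj a // IsGenerator y} :=
    (MulAction.orbitRel (Aut A) (A.obj.obj a)).comap Subtype.val
  have := Fintype.ofFinite (Quotient r)
  have hid : ∑ q : Quotient r, (tmk M a).flip (Finsupp.single q.out.1 1) ∘ₗ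
      orbitCoeff q.out.2 = LinearMap.id := by
    refine tensorLower_hom_ext fun m y hy => ?_
    simp only [LinearMap.sum_apply, LinearMap.comp_apply, LinearMap.flip_apply,
      orbitCoeff_tmk_single, LinearMap.id_apply]
    rw [Finset.sum_eq_single (Quotient.mk r ⟨y, hy⟩) (fun q _ hq => ?_) (by simp)]
    · exact tmk_orbitMap_single (Quotient.mk r ⟨y, hy⟩).out.2
        (Setoid.symm (Quotient.mk_out (s := r) ⟨y, hy⟩)) m
    · have hyq : y ∉ MulAction.orbit (Aut A) q.out.1 := fun h =>
        hq (q.out_eq.symm.trans (Quotient.sound (s := r) (Setoid.symm h)))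
      rw [orbitMap_of_notMem_orbit _ hyq, LinearMap.zero_apply, map_zero, LinearMap.zero_apply]
  by_contra! h
  refine ht ((LinearMap.congr_fun hid t).symm.trans ?_)
  simp only [LinearMap.sum_apply, LinearMap.comp_apply, h, map_zero, Finset.sum_const_zero]

lemma linearCombination_map_tmk_single {b : 𝒜} (u : (a ⟶ b) →₀ k) (m : M) (y : A.obj.obj a) :
    Finsupp.linearCombination k (fun f => ((tensorLower M).map f).hom) u
      (tmk M a m (Finsupp.single y 1)) = tmk M b m (Finsupp.mapDomain (act y b) u) := by
  induction u using Finsupp.induction_linear with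
  | zero => simp
  | add u v hu hv => simp only [map_add, LinearMap.add_apply, hu, hv, Finsupp.mapDomain_add]
  | single f r =>
    rw [Finsupp.linearCombination_single, LinearMap.smul_apply, map_tmk, linMap,
      Finsupp.lmapDomain_apply, Finsupp.mapDomain_single, Finsupp.mapDomain_single, ← map_smul,
      Finsupp.smul_single, smul_eq_mul, mul_one, act_apply]

lemma mapDomain_act_smul {b : 𝒜} (u : (a ⟶ b) →₀ k) (g : Aut A) (y : A.obj.obj a) :
    Finsupp.mapDomain (act (g • y) b) u = linRep k A b g (Finsupp.mapDomain (act y b) u) := by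
  have h : act (g • y) b = (g • · : A.obj.obj b → A.obj.obj b) ∘ act y b :=
    funext fun f => map_aut_smul f g y
  rw [h, Finsupp.mapDomain_comp]
  rfl

lemma exists_linearCombination_map_eq_tmk_orbitCoeff (hA : HasInvertibleValues k A)
    (hz : IsGenerator z) {b : 𝒜} {ξ : A.obj.obj b →₀ k} (hξ : ξ ∈ quotKer k A b) :
    ∃ u : (a ⟶ b) →₀ k, ∀ t : (tensorLower M).obj a,
      Finsupp.linearCombination k (fun f => ((tensorLower M).map f).hom) u t =
        tmk M b (orbitCoeff hz t) ξ := by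
  obtain ⟨u, hu, hu'⟩ := exists_mapDomain_act_eq_of_mem_quotKer hA hz hξ
  refine ⟨u, LinearMap.congr_fun (g := (tmk M b).flip ξ ∘ₗ orbitCoeff hz)
    (tensorLower_hom_ext fun m y hy => ?_)⟩
  rw [linearCombination_map_tmk_single, LinearMap.comp_apply, LinearMap.flip_apply,
    orbitCoeff_tmk_single]
  by_cases hyz : y ∈ MulAction.orbit (Aut A) z
  · obtain ⟨α, rfl⟩ := hyz
    dsimp only
    rw [mapDomain_act_smul, hu, tmk_linRep, orbitMap_smul M.ρ hz]
  · rw [hu' y hy hyz, orbitMap_of_notMem_orbit _ hyz, map_zero, LinearMap.zero_apply, map_zero,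
      LinearMap.zero_apply]

lemma mem_properSum_of_tmk_single_eq_zero {b : 𝒜} (hz : IsGenerator z) {x : A.obj.obj b →₀ k}
    (h : tmk (Rep.of (linRep k A a)) b (Finsupp.single z 1) x = 0) : x ∈ properSum k A b := by
  let q := (properSum k A b).mkQ
  let β (y : A.obj.obj b) : (A.obj.obj a →₀ k) →ₗ[k] (A.obj.obj b →₀ k) ⧸ properSum k A b :=
    Finsupp.linearCombination k fun z' => orbitMap (QlowerRep k A b) z z' (q (Finsupp.single y 1))
  have hβ (g : Aut A) (y : A.obj.obj b) (m : A.obj.obj a →₀ k) :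
      β (g • y) (linRep k A a g m) = β y m := by
    have hq : q (Finsupp.single (g • y) 1) = QlowerRep k A b g (q (Finsupp.single y 1)) :=
      congrArg q (linRep_single g y 1).symm
    induction m using Finsupp.induction_linear with
    | zero => simp
    | add m m' hm hm' => simp only [map_add, hm, hm']
    | single z' r =>
      simp only [β, linRep_single, Finsupp.linearCombination_single, hq,
        orbitMap_smul_apply _ hz]
  have hβ' (y : A.obj.obj b) (hy : ¬ IsGenerator y) : β y = 0 := by
    have hq : q (Finsupp.single y 1) = 0 :=
      (Submodule.Quotient.mk_eq_zero _).2 (single_mem_properSum hy 1)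
    exact Finsupp.lhom_ext fun z' r => by simp [β, hq]
  have hφ : tensorLowerLift (M := Rep.of (linRep k A a)) β hβ hβ' ∘ₗ
      tmk (Rep.of (linRep k A a)) b (Finsupp.single z 1) = q := by
    refine Finsupp.lhom_ext' fun y => LinearMap.ext_ring ?_
    change Finsupp.linearCombination k β (Finsupp.single y 1) (Finsupp.single z 1) =
      q (Finsupp.single y 1)
    simp [β, orbitMap_self _ hz]
  refine (Submodule.Quotient.mk_eq_zero _).1 ((LinearMap.congr_fun hφ x).symm.trans ?_)
  rw [LinearMap.comp_apply, h, map_zero]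

variable [HasBinaryBiproducts 𝒜] {d : 𝒜}

lemma shift_mem_orbit_iff (hz : IsGenerator z) {y y' : A.obj.obj d} :
    shift z y' ∈ MulAction.orbit (Aut A) (shift z y) ↔ y' = y := by
  refine ⟨fun ⟨α, hα⟩ => ?_, fun h => h ▸ MulAction.mem_orbit_self _⟩
  have hα1 : α = 1 := hz.eq_of_smul_eq (by
    simpa [map_aut_smul] using congrArg (A.obj.map biprod.snd).hom hα)
  subst hα1
  exact shift_injective z (by simpa using hα.symm)

lemma orbitCoeff_tmk_mapDomain_shift (hz : IsGenerator z) (m : M) (ζ : A.obj.obj d →₀ k)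
    (y : A.obj.obj d) :
    orbitCoeff (hz.shift y) (tmk M (d ⊞ a) m (Finsupp.mapDomain (shift z) ζ)) = ζ y • m := by
  rw [orbitCoeff_tmk, Finsupp.linearCombination_mapDomain, Finsupp.linearCombination_apply,
    Finsupp.sum_eq_single y, Function.comp_apply, orbitMap_self M.ρ (hz.shift y)]
  · rfl
  · intro y' _ hy'
    rw [Function.comp_apply, orbitMap_of_notMem_orbit, smul_zero]
    rwa [shift_mem_orbit_iff hz]
  · simp

lemma exists_tmk_ne_zero (hz : IsGenerator z) {ζ : A.obj.obj d →₀ k} (hζ : ζ ∈ quotKer k A d)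
    (hζ0 : ζ ≠ 0) {m : M} (hm : m ≠ 0) :
    ∃ ξ ∈ quotKer k A (d ⊞ a), tmk M (d ⊞ a) m ξ ≠ 0 := by
  obtain ⟨y, hy⟩ := Finsupp.ne_iff.1 hζ0
  refine ⟨_, mapDomain_shift_mem_quotKer hζ z, fun h0 => smul_ne_zero hy hm ?_⟩
  rw [← orbitCoeff_tmk_mapDomain_shift hz m ζ y, h0, map_zero]

end Orbits

section FunctorElements

variable {R : Type*} [Ring R] {C : Type*} [Category* C] {F G H : C ⥤ ModuleCat.{w} R}

lemma comp_eq_zero_iff (φ : F ⟶ G) (ψ : G ⟶ H) :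
    φ ≫ ψ = 0 ↔ ∀ a x, (ψ.app a).hom ((φ.app a).hom x) = 0 := by
  refine ⟨fun h a x => ?_, fun h => by ext a x; exact h a x⟩
  exact congrArg (fun χ : F ⟶ H => (χ.app a).hom x) h

lemma mono_iff_injective (φ : F ⟶ G) : Mono φ ↔ ∀ a, Function.Injective (φ.app a).hom := by
  rw [NatTrans.mono_iff_mono_app]
  exact forall_congr' fun a => ModuleCat.mono_iff_injective _

lemma epi_iff_surjective (φ : F ⟶ G) : Epi φ ↔ ∀ a, Function.Surjective (φ.app a).hom := by
  rw [NatTrans.epi_iff_epi_app]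
  exact forall_congr' fun a => ModuleCat.epi_iff_surjective _

end FunctorElements

section Linearization

variable (k : Type w) [Field k] {A B : 𝒜 ⥤+ AddCommGrpCat.{w}}

/-- The morphism `k[A] ⟶ k[B]` induced by a morphism `A ⟶ B`. -/
def linHom (φ : A ⟶ B) : linearization k A ⟶ linearization k B :=
  Functor.whiskerRight φ.hom (forget AddCommGrpCat.{w} ⋙ ModuleCat.free k)

instance (φ : A ⟶ B) [Mono φ] : Mono (linHom k φ) :=
  (mono_iff_injective _).2 fun a => Finsupp.mapDomain_injective (addHom_injective_of_mono φ a)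

instance (φ : A ⟶ B) [Epi φ] : Epi (linHom k φ) :=
  (epi_iff_surjective _).2 fun a => Finsupp.mapDomain_surjective (addHom_surjective_of_epi φ a)

variable {k} in
lemma IsSubquotient.linearization (h : IsSubquotient B A) {S : 𝒜 ⥤ ModuleCat.{w} k}
    (hS : IsSubquotient S (AddRepLin.linearization k B)) :
    IsSubquotient S (AddRepLin.linearization k A) := by
  obtain ⟨Z, i, p, _, _⟩ := h
  exact (hS.of_epi_right (linHom k p)).of_mono (linHom k i)

lemma AddSubfunctor.le_of_mk_linHom_ι_le {B B' : AddSubfunctor A}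
    (h : Subobject.mk (linHom k B.ι) ≤ Subobject.mk (linHom k B'.ι)) : B ≤ B' := by
  intro a x hx
  let ξ : B.obj a →₀ k := Finsupp.single ⟨x, hx⟩ 1
  let η : B'.obj a →₀ k := ((Subobject.ofMkLEMk _ _ h).app a).hom ξ
  have hη : Finsupp.mapDomain (B'.obj a).subtype η = Finsupp.single x 1 :=
    (congrArg (fun φ => (φ.app a).hom ξ) (Subobject.ofMkLEMk_comp h)).trans
      Finsupp.mapDomain_single
  by_contra hx'
  have h0 := DFunLike.congr_fun hη x
  rw [Finsupp.mapDomain_of_notMem_range _ _ (by simpa using hx'), Finsupp.single_eq_same] at h0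
  exact zero_ne_one h0

lemma AddSubfunctor.mk_linHom_ι_le_iff {B B' : AddSubfunctor A} :
    Subobject.mk (linHom k B.ι) ≤ Subobject.mk (linHom k B'.ι) ↔ B ≤ B' := by
  refine ⟨le_of_mk_linHom_ι_le k, fun h => ?_⟩
  obtain ⟨l, hl⟩ := exists_addHom_factor B'.ι B.ι (by rwa [range_ι, range_ι])
  refine Subobject.mk_le_mk_of_comm (linHom k l) ?_
  rw [← hl]
  exact (Functor.whiskerRight_comp _ _ _).symm

variable {k} in
lemma isFiniteLength_of_linearization (h : IsFiniteLength (linearization k A)) :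
    IsFiniteLength A := by
  obtain ⟨_, _⟩ := (isFiniteLength_iff _).1 h
  have hmono : StrictMono fun B : AddSubfunctor A => Subobject.mk (linHom k B.ι) :=
    strictMono_of_le_iff_le fun _ _ => (AddSubfunctor.mk_linHom_ι_le_iff k).symm
  exact AddSubfunctor.isFiniteLength_iff.2 ⟨hmono.wellFoundedLT, hmono.wellFoundedGT⟩

end Linearization

/-! ### Simplicity of `Q(A, M)` -/

section Irreducible

lemma eq_top_of_mem_of_ne_zero {K G V : Type*} [Field K] [Monoid G] [AddCommGroup V]
    [Module K V] {ρ : Representation K G V} [ρ.IsIrreducible] {N : Subrepresentation ρ} {v : V}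
    (hv : v ∈ N) (hv0 : v ≠ 0) : N = ⊤ :=
  (eq_bot_or_eq_top N).resolve_left fun h => hv0 (by rwa [h] at hv)

lemma nontrivial_of_isIrreducible {K G V : Type*} [Field K] [Monoid G] [AddCommGroup V]
    [Module K V] (ρ : Representation K G V) [ρ.IsIrreducible] : Nontrivial V := by
  by_contra! h
  exact bot_ne_top (α := Subrepresentation ρ)
    (Subrepresentation.toSubmodule_injective (Subsingleton.elim _ _))

variable {k : Type w} [Field k] {A : 𝒜 ⥤+ AddCommGrpCat.{w}} {M : Rep.{w} k (Aut A)}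

lemma tmk_mem_of_isIrreducible [M.ρ.IsIrreducible] {a : 𝒜} {S : Submodule k (A.obj.obj a →₀ k)}
    (hS : ∀ g, S ≤ S.comap (linRep k A a g)) {N : Submodule k ((tensorLower M).obj a)} {m : M}
    (hm : m ≠ 0) (h : ∀ x ∈ S, tmk M a m x ∈ N) (m' : M) {x : A.obj.obj a →₀ k} (hx : x ∈ S) :
    tmk M a m' x ∈ N := by
  let L : Subrepresentation M.ρ :=
    { toSubmodule := ⨅ x : S, N.comap ((tmk M a).flip x)
      apply_mem_toSubmodule := fun g m' hm' => by
        simp only [Submodule.mem_iInf, Submodule.mem_comap, LinearMap.flip_apply,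
          Subtype.forall] at hm' ⊢
        intro x hx
        rw [← (linRep k A a).self_inv_apply g x, tmk_act]
        exact hm' _ (hS g⁻¹ hx) }
  have hL : L = ⊤ := eq_top_of_mem_of_ne_zero
    (show m ∈ L.toSubmodule from (Submodule.mem_iInf _).2 fun x => h x.1 x.2) hm
  have hm' : m' ∈ L.toSubmodule := by rw [hL]; exact Submodule.mem_top
  exact (Submodule.mem_iInf _).1 hm' ⟨x, hx⟩

/-- The morphism `k[A] ⟶ M ⊗_{k[Aut(A)]} Q_A` given by an element of `M`. -/
def linTo (m : M) : linearization k A ⟶ tensorLower M where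
  app a := ModuleCat.ofHom (X := A.obj.obj a →₀ k) (tmk M a m)
  naturality _ _ _ := rfl

lemma linTo_epi [M.ρ.IsIrreducible] {m : M} (hm : m ≠ 0) : Epi (linTo m) := by
  refine (epi_iff_surjective _).2 fun a => LinearMap.range_eq_top.1 ?_
  refine submodule_tensorLower_eq_top fun m' y _ => ?_
  exact tmk_mem_of_isIrreducible (S := ⊤) (fun _ _ _ => Submodule.mem_top) hm
    (fun x _ => LinearMap.mem_range_self (tmk M a m) x) m' Submodule.mem_top

lemma Q_isSubquotient_linearization (M : Rep.{w} k (Aut A)) [M.ρ.IsIrreducible] :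
    IsSubquotient (Q M) (linearization k A) := by
  have := nontrivial_of_isIrreducible M.ρ
  obtain ⟨m, hm⟩ := exists_ne (0 : M)
  have := linTo_epi hm
  have hQ : IsSubquotient (Q M) (tensorLower M) :=
    ⟨Q M, image.ι (tensorHom M), 𝟙 _, inferInstanceAs (Mono (image.ι (tensorHom M))), inferInstance⟩
  exact hQ.of_epi_right (linTo m)

lemma range_tensorHom_le_range_of_ne_zero (hA : HasInvertibleValues k A) [M.ρ.IsIrreducible]
    {Y : 𝒜 ⥤ ModuleCat.{w} k} {j : Y ⟶ tensorLower M} (hj : j ≠ 0) (b : 𝒜) :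
    LinearMap.range ((tensorHom M).app b).hom ≤ LinearMap.range (j.app b).hom := by
  obtain ⟨a, y, hy⟩ : ∃ a y, (j.app a).hom y ≠ 0 := by
    by_contra! h
    exact hj (by ext a y; exact h a y)
  have := (hA a).1
  obtain ⟨z, hz, hm⟩ := exists_orbitCoeff_ne_zero hy
  refine range_tensorHom_le_iff.2 fun m' ξ hξ => ?_
  refine tmk_mem_of_isIrreducible (fun g => quotKer_le_comap_linEnd k A g b) hm
    (fun ξ hξ => ?_) m' hξ
  obtain ⟨u, hu⟩ := exists_linearCombination_map_eq_tmk_orbitCoeff (M := M) hA hz hξ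
  rw [← hu, Finsupp.linearCombination_apply, LinearMap.finsupp_sum_apply]
  refine Submodule.sum_mem _ fun f _ => Submodule.smul_mem _ _ ⟨(Y.map f).hom y, ?_⟩
  exact ConcreteCategory.congr_hom (j.naturality f) y

variable [Nonempty 𝒜] [HasBinaryBiproducts 𝒜]

lemma tensorHom_ne_zero (hA : HasInvertibleValues k A) (hA' : IsFiniteLength A) [Nontrivial M] :
    tensorHom M ≠ 0 := by
  obtain ⟨_, _⟩ := AddSubfunctor.isFiniteLength_iff.1 hA'
  obtain ⟨m, hm⟩ := exists_ne (0 : M)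
  obtain ⟨a, x, hx⟩ := exists_isGenerator A
  obtain ⟨c, hc⟩ := exists_isCogenerating A
  have := (hA c).1
  obtain ⟨d, ζ, hζ, hζ0⟩ := exists_mem_quotKer_ne_zero k hc
  obtain ⟨ξ, hξ, hne⟩ := exists_tmk_ne_zero hx hζ hζ0 hm
  intro h0
  have hle : LinearMap.range ((tensorHom M).app (d ⊞ a)).hom ≤ ⊥ := by
    rw [h0]
    exact LinearMap.range_zero.le
  exact hne (range_tensorHom_le_iff.1 hle m ξ hξ)

lemma simple_Q (hA : HasInvertibleValues k A) (hA' : IsFiniteLength A) (M : Rep.{w} k (Aut A))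
    [M.ρ.IsIrreducible] : Simple (Q M) := by
  have := nontrivial_of_isIrreducible M.ρ
  let ι : Q M ⟶ tensorLower M := image.ι (tensorHom M)
  let e : tensorUpper M ⟶ Q M := factorThruImage (tensorHom M)
  have hιe : e ≫ ι = tensorHom M := image.fac _
  have : Mono ι := inferInstanceAs (Mono (image.ι (tensorHom M)))
  have : Epi e := inferInstanceAs (Epi (factorThruImage (tensorHom M)))
  refine ⟨fun {Y} j _ => ⟨fun _ h0 => tensorHom_ne_zero hA hA' (M := M) ?_, fun hj => ?_⟩⟩
  · rw [← hιe, (IsZero.of_epi_eq_zero j h0).eq_zero_of_src ι, comp_zero]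
  · have hjι : j ≫ ι ≠ 0 := fun h => hj (zero_of_comp_mono ι h)
    have : Epi j := by
      refine (epi_iff_surjective _).2 fun b q => ?_
      obtain ⟨z, rfl⟩ := (epi_iff_surjective e).1 inferInstance b q
      obtain ⟨y, hy⟩ := range_tensorHom_le_range_of_ne_zero hA hjι b ⟨z, rfl⟩
      rw [← hιe] at hy
      exact ⟨y, (mono_iff_injective ι).1 inferInstance b hy⟩
    exact isIso_of_mono_of_epi j

end Irreducible

/-! ### Composition factors of `k[A]` -/

section FiniteDimensional

lemma rep_induction {K G : Type*} [Field K] [Monoid G] {p : Rep.{w} K G → Prop}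
    (subsingleton : ∀ M : Rep.{w} K G, Subsingleton M → p M)
    (irreducible : ∀ M : Rep.{w} K G, M.ρ.IsIrreducible → p M)
    (extension : ∀ (M : Rep.{w} K G) (N : Submodule K M) (hN : ∀ g, N ≤ N.comap (M.ρ g)),
      p (M.subrepresentation N hN) → p (M.quotient N hN) → p M)
    (M : Rep.{w} K G) [Module.Finite K M] : p M := by
  induction hn : Module.finrank K M using Nat.strong_induction_on generalizing M with
  | _ n ih =>
    subst hn
    rcases subsingleton_or_nontrivial M with hM | _
    · exact subsingleton M hM
    by_cases hirr : M.ρ.IsIrreducible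
    · exact irreducible M hirr
    obtain ⟨N, hbot, htop⟩ : ∃ N : Subrepresentation M.ρ, N ≠ ⊥ ∧ N ≠ ⊤ := by
      by_contra! h
      have : Nontrivial (Subrepresentation M.ρ) := ⟨⊥, ⊤, fun h =>
        bot_ne_top (congrArg Subrepresentation.toSubmodule h)⟩
      exact hirr ⟨fun N => or_iff_not_imp_left.2 (h N)⟩
    have hbot' : N.toSubmodule ≠ ⊥ := fun h =>
      hbot (Subrepresentation.toSubmodule_injective h)
    have htop' : N.toSubmodule ≠ ⊤ := fun h =>
      htop (Subrepresentation.toSubmodule_injective h)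
    have : Nontrivial N.toSubmodule := Submodule.nontrivial_iff_ne_bot.2 hbot'
    have hpos : 0 < Module.finrank K N.toSubmodule := Module.finrank_pos
    have hadd := N.toSubmodule.finrank_quotient_add_finrank
    have hquot : Module.finrank K (M ⧸ N.toSubmodule) < Module.finrank K M := by omega
    have : Module.Finite K (M.subrepresentation N.toSubmodule N.apply_mem_toSubmodule) :=
      inferInstanceAs (Module.Finite K N.toSubmodule)
    have : Module.Finite K (M.quotient N.toSubmodule N.apply_mem_toSubmodule) :=
      inferInstanceAs (Module.Finite K (M ⧸ N.toSubmodule))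
    exact extension M N.toSubmodule N.apply_mem_toSubmodule
      (ih _ (Submodule.finrank_lt htop') _ rfl) (ih _ hquot _ rfl)

end FiniteDimensional

section Devissage

variable {k : Type w} [Field k] {A : 𝒜 ⥤+ AddCommGrpCat.{w}}

/-- The functoriality of `M ⊗_{k[Aut(A)]} Q_A` in `M`. -/
def tensorLowerMap {M M' : Rep.{w} k (Aut A)} (f : M ⟶ M') : tensorLower M ⟶ tensorLower M' :=
  Functor.whiskerLeft (Qlower k A) ((Rep.coinvariantsTensor k (Aut A)).map f)

lemma mem_range_tensorLowerMap_subtype {M : Rep.{w} k (Aut A)} {N : Submodule k M}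
    {hN : ∀ g, N ≤ N.comap (M.ρ g)} {a : 𝒜} {t : (tensorLower M).obj a}
    (ht : ((tensorLowerMap (M.mkQ N hN)).app a).hom t = 0) :
    t ∈ LinearMap.range ((tensorLowerMap (M.subtype N hN)).app a).hom := by
  let R := LinearMap.range ((tensorLowerMap (M.subtype N hN)).app a).hom
  let β (y : A.obj.obj a) : M ⧸ N →ₗ[k] (tensorLower M).obj a ⧸ R :=
    N.liftQ (R.mkQ ∘ₗ (tmk M a).flip (Finsupp.single y 1)) fun m hm =>
      (Submodule.Quotient.mk_eq_zero _).2
        ⟨tmk (M.subrepresentation N hN) a (⟨m, hm⟩ : N) (Finsupp.single y 1), rfl⟩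
  have hβ (g : Aut A) (y : A.obj.obj a) (m : M ⧸ N) :
      β (g • y) ((M.quotient N hN).ρ g m) = β y m := by
    obtain ⟨m, rfl⟩ := N.mkQ_surjective m
    refine congrArg R.mkQ (Eq.trans ?_ (tmk_act a g m (Finsupp.single y 1)))
    rw [linRep_single, LinearMap.flip_apply]
  have hβ' (y : A.obj.obj a) (hy : ¬ IsGenerator y) : β y = 0 := by
    refine Submodule.linearMap_qext _ (LinearMap.ext fun m => ?_)
    exact (congrArg R.mkQ (tmk_of_mem_properSum m (single_mem_properSum hy 1))).trans (map_zero _)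
  have hlift : tensorLowerLift (M := M.quotient N hN) β hβ hβ' ∘ₗ
      ((tensorLowerMap (M.mkQ N hN)).app a).hom = R.mkQ := by
    refine tensorLower_hom_ext fun m y _ => ?_
    change Finsupp.linearCombination k β (Finsupp.single y 1) (N.mkQ m) = _
    rw [Finsupp.linearCombination_single, one_smul]
    rfl
  refine (Submodule.Quotient.mk_eq_zero _).1 ((LinearMap.congr_fun hlift t).symm.trans ?_)
  rw [LinearMap.comp_apply, ht, map_zero]

variable (P : ObjectProperty (𝒜 ⥤ ModuleCat.{w} k)) [P.IsSerreClass]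

lemma prop_tensorLower_of_subrepresentation {M : Rep.{w} k (Aut A)} {N : Submodule k M}
    {hN : ∀ g, N ≤ N.comap (M.ρ g)} (hsub : P (tensorLower (M.subrepresentation N hN)))
    (hquot : P (tensorLower (M.quotient N hN))) : P (tensorLower M) := by
  refine prop_of_family_from P (ι := Unit) (fun _ => hsub)
    (fun _ => tensorLowerMap (M.subtype N hN)) fun T g _ hg => ?_
  refine prop_of_family_to P (ι := Unit) (fun _ => hquot)
    (fun _ => tensorLowerMap (M.mkQ N hN)) g fun K j hj => ?_
  refine (comp_eq_zero_iff _ _).2 fun a x => ?_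
  obtain ⟨s, hs⟩ := mem_range_tensorLowerMap_subtype ((comp_eq_zero_iff _ _).1 (hj ()) a x)
  rw [← hs]
  exact (comp_eq_zero_iff _ _).1 (hg ()) a s

lemma prop_tensorLower_of_finite
    (hP : ∀ M : Rep.{w} k (Aut A), M.ρ.IsIrreducible → P (tensorLower M))
    (M : Rep.{w} k (Aut A)) [Module.Finite k M] : P (tensorLower M) := by
  induction M using rep_induction with
  | subsingleton M _ =>
    have htop (a : 𝒜) : (⊥ : Submodule k ((tensorLower M).obj a)) = ⊤ :=
      submodule_tensorLower_eq_top fun m y _ => by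
        rw [Subsingleton.elim m 0, map_zero]
        exact Submodule.zero_mem _
    refine P.prop_of_isZero ((IsZero.iff_id_eq_zero _).2 ?_)
    ext a t
    exact (Submodule.mem_bot k).1 ((htop a).ge trivial)
  | irreducible M hM => exact hP M hM
  | extension M N hN hsub hquot => exact prop_tensorLower_of_subrepresentation P hsub hquot

lemma prop_tensorLower_of_isIrreducible (M : Rep.{w} k (Aut A)) [M.ρ.IsIrreducible] {c : 𝒜}
    (hc : IsCogenerating A c) [Finite (A.obj.obj c)] (hQ : P (Q M))
    (hquot : ∀ B : AddSubfunctor A, B.IsNonzero → P (linearization k B.quot)) :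
    P (tensorLower M) := by
  let ι : Q M ⟶ tensorLower M := image.ι (tensorHom M)
  have hι : tensorHom M ≫ cokernel.π ι = 0 := by
    rw [← image.fac (tensorHom M), Category.assoc]
    exact (congrArg _ (cokernel.condition ι)).trans comp_zero
  have := nontrivial_of_isIrreducible M.ρ
  obtain ⟨m, hm⟩ := exists_ne (0 : M)
  have := linTo_epi hm
  refine P.prop_X₂_of_exact (ShortComplex.exact_cokernel ι) hQ ?_
  refine prop_of_family_to P (ι := {y : A.obj.obj c // y ≠ 0})
    (Z := fun y => linearization k (AddSubfunctor.gen y.1).quot)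
    (fun y => hquot _ ⟨c, fun h0 => y.2 ?_⟩)
    (fun y => linHom k (AddSubfunctor.gen y.1).π) (linTo m ≫ cokernel.π ι) fun K j hj => ?_
  · simpa [h0] using AddSubfunctor.self_mem_gen y.1
  refine (comp_eq_zero_iff _ _).2 fun b z => ?_
  have hz : (j.app b).hom z ∈ quotKer k A b := (mem_quotKer_iff_of_isCogenerating hc).2
    fun y hy => (comp_eq_zero_iff _ _).1 (hj ⟨y, hy⟩) b z
  have hker : LinearMap.range ((tensorHom M).app b).hom ≤
      LinearMap.ker ((cokernel.π ι).app b).hom := by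
    rintro _ ⟨t, rfl⟩
    exact (comp_eq_zero_iff _ _).1 hι b t
  exact range_tensorHom_le_iff.1 hker m _ hz

lemma prop_linearization {a : 𝒜} {x : A.obj.obj a} (hx : IsGenerator x) [Finite (A.obj.obj a)]
    (hsub : ∀ B : AddSubfunctor A, B.IsProper → P (linearization k B.toFunctor))
    (hP : P (tensorLower (Rep.of (linRep k A a)))) : P (linearization k A) := by
  -- A proper subfunctor is contained in `largest H` for some `H ≠ ⊤`, as it does not contain `x`.
  refine prop_of_family_from P (ι := {H : AddSubgroup (A.obj.obj a) // H ≠ ⊤})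
    (Z := fun H => linearization k (AddSubfunctor.largest H.1).toFunctor)
    (fun H => hsub _ ⟨a, fun h => H.2 (top_unique ?_)⟩)
    (fun H => linHom k (AddSubfunctor.largest H.1).ι) fun T g _ hg => ?_
  · exact h.ge.trans (AddSubfunctor.le_largest_iff.1 le_rfl)
  have hker (b : 𝒜) : properSum k A b ≤ LinearMap.ker (g.app b).hom := by
    refine properSum_le_iff.2 fun y hy => ?_
    obtain ⟨B, hB, hyB⟩ : ∃ B : AddSubfunctor A, B.IsProper ∧ y ∈ B.obj b := by
      simpa [isGenerator_iff] using hy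
    have hBa : B.obj a ≠ ⊤ := fun h => isGenerator_iff.1 hx B hB (h.ge trivial)
    have hy' : y ∈ (AddSubfunctor.largest (B.obj a)).obj b :=
      AddSubfunctor.le_largest_iff.2 le_rfl b hyB
    have h0 := (comp_eq_zero_iff _ _).1 (hg ⟨B.obj a, hBa⟩) b (Finsupp.single ⟨y, hy'⟩ 1)
    exact (congrArg (g.app b).hom Finsupp.mapDomain_single.symm).trans h0
  refine prop_of_family_to P (ι := Unit) (fun _ => hP)
    (fun _ => linTo (M := Rep.of (linRep k A a)) (Finsupp.single x 1)) g fun K j hj => ?_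
  exact (comp_eq_zero_iff _ _).2 fun b z =>
    hker b (mem_properSum_of_tmk_single_eq_zero hx ((comp_eq_zero_iff _ _).1 (hj ()) b z))

end Devissage

section CompositionFactors

variable {k : Type w} [Field k] {A : 𝒜 ⥤+ AddCommGrpCat.{w}}

variable (k) in
/-- `S` is isomorphic to `Q(B, M)` for some subquotient `B` of `A` and some simple `M`: these are
the composition factors of `k[A]`. -/
def IsQFactor (A : 𝒜 ⥤+ AddCommGrpCat.{w}) (S : 𝒜 ⥤ ModuleCat.{w} k) : Prop :=
  ∃ (B : 𝒜 ⥤+ AddCommGrpCat.{w}) (M : Rep.{w} k (Aut B)),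
    IsSubquotient B A ∧ M.ρ.IsIrreducible ∧ Nonempty (S ≅ Q M)

variable [Nonempty 𝒜] [HasBinaryBiproducts 𝒜]

lemma finiteLengthWithFactors_linearization (hA : HasInvertibleValues k A)
    (hA' : IsFiniteLength A) :
    finiteLengthWithFactors (IsQFactor k A) (linearization k A) := by
  obtain ⟨_, _⟩ := AddSubfunctor.isFiniteLength_iff.1 hA'
  refine AddSubfunctor.subquotient_induction
    (fun B => finiteLengthWithFactors (IsQFactor k A) (linearization k B))
    fun B hBA hB hsub hquot => ?_
  have hBval := hA.of_isSubquotient hBA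
  have hfin (a : 𝒜) : Finite (B.obj.obj a) := (hBval a).1
  obtain ⟨_, _⟩ := AddSubfunctor.isFiniteLength_iff.1 hB
  obtain ⟨a, x, hx⟩ := exists_isGenerator B
  obtain ⟨c, hc⟩ := exists_isCogenerating B
  have : Module.Finite k (Rep.of (linRep k B a)) :=
    inferInstanceAs (Module.Finite k (B.obj.obj a →₀ k))
  refine prop_linearization _ hx hsub (prop_tensorLower_of_finite _ (fun M _ => ?_) _)
  have := simple_Q hBval hB M
  exact prop_tensorLower_of_isIrreducible _ M hc
    (finiteLengthWithFactors_of_simple fun T hT => ⟨B, M, hBA, inferInstance, hT⟩) hquot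

lemma isCompositionFactor_linearization_iff (hA : HasInvertibleValues k A)
    (hA' : IsFiniteLength A) {S : 𝒜 ⥤ ModuleCat.{w} k} :
    IsCompositionFactor S (linearization k A) ↔ IsQFactor k A S := by
  obtain ⟨hlength, hfactors⟩ := finiteLengthWithFactors_linearization hA hA'
  rw [isCompositionFactor_iff hlength]
  refine ⟨fun ⟨hS, hSA⟩ => hfactors S hS hSA, ?_⟩
  rintro ⟨B, M, hBA, hM, ⟨e⟩⟩
  have := simple_Q (hA.of_isSubquotient hBA) (hBA.isFiniteLength hA') M
  exact ⟨Simple.of_iso e,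
    hBA.linearization ((Q_isSubquotient_linearization M).of_epi e.inv)⟩

end CompositionFactors

end AddRepLin

end

theorem mainTheorem5_general {k : Type w} [Field k]
    {𝒜 : Type u} [Category.{v} 𝒜] [Nonempty 𝒜] [Preadditive 𝒜] [HasBinaryBiproducts 𝒜]
    {A : 𝒜 ⥤+ AddCommGrpCat.{w}}
    (hA : AddRepLin.IsFiniteLength A → AddRepLin.HasInvertibleValues k A) :
    (AddRepLin.IsFiniteLength (AddRepLin.linearization k A) ↔ AddRepLin.IsFiniteLength A) ∧
    (AddRepLin.IsFiniteLength A →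
      ∀ S : 𝒜 ⥤ ModuleCat.{w} k,
        AddRepLin.IsCompositionFactor S (AddRepLin.linearization k A) ↔
          ∃ (B : 𝒜 ⥤+ AddCommGrpCat.{w}) (M : Rep.{w} k (Aut B)),
            AddRepLin.IsSubquotient B A ∧ M.ρ.IsIrreducible ∧
              Nonempty (S ≅ AddRepLin.Q M)) :=
  ⟨⟨AddRepLin.isFiniteLength_of_linearization,
      fun hA' => (AddRepLin.finiteLengthWithFactors_linearization (hA hA') hA').1⟩,
    fun hA' _ => AddRepLin.isCompositionFactor_linearization_iff (hA hA') hA'⟩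

theorem mainTheorem5 (k : Type w) [Field k]
    (𝒜 : Type u) [Category.{v} 𝒜] [EssentiallySmall.{w} 𝒜] [Preadditive 𝒜] [HasFiniteBiproducts 𝒜]
    (h𝒜 : AddRepLin.IsTrivialFor k 𝒜) (A : 𝒜 ⥤+ AddCommGrpCat.{w}) :
    (AddRepLin.IsFiniteLength (AddRepLin.linearization k A) ↔ AddRepLin.IsFiniteLength A) ∧
    (AddRepLin.IsFiniteLength A →
      ∀ S : 𝒜 ⥤ ModuleCat.{w} k,
        AddRepLin.IsCompositionFactor S (AddRepLin.linearization k A) ↔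
          ∃ (B : 𝒜 ⥤+ AddCommGrpCat.{w}) (M : Rep.{w} k (Aut B)),
            AddRepLin.IsSubquotient B A ∧ M.ρ.IsIrreducible ∧
              Nonempty (S ≅ AddRepLin.Q M)) := by
  have : HasZeroObject 𝒜 := hasZeroObject_of_hasFiniteBiproducts 𝒜
  have : HasBinaryBiproducts 𝒜 := hasBinaryBiproducts_of_finite_biproducts 𝒜
  have : Nonempty 𝒜 := (HasZeroObject.zero (C := 𝒜)).nonempty
  exact mainTheorem5_general h𝒜.hasInvertibleValues
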